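/- An instance of generalized min sum set cover (GMSSC) is a finite hypergraph $(V,E)$ together with a covering requirement $1\le k_e\le |e|$ for every hyperedge $e\in E$. Given an ordering of the $n=|V|$ vertices, i.e. a bijective assignment of the vertices to the time slots $1,\dots,n$, the cover time of $e$ is the earliest time by which $k_e$ vertices of $e$ have appeared, and the cost of the ordering is the sum of the cover times of all hyperedges. The knapsack-cover LP has variables $x_{v,t},u_{e,t}\ge 0$ ($v\in V$, $e\in E$, $t=1,2,\dots$) and reads: minimize $\sum_{e,t}u_{e,t}$ subject to $\sum_v x_{v,t}\le 1$ for all $t$, and $$(k_e-|S|)\,u_{e,t}+\sum_{v\in e\setminus S}\ \sum_{t'<t}x_{v,t'}\ \ge\ k_e-|S|\qquad\text{for all } e,\ t \text{ and } S\subseteq e \text{ with } |S|<k_e .$$ For $\beta\ge 1$ consider the following randomized algorithm. Take an optimum solution $(x,u)$ of this LP (one always exists). Apply the kernel $K(t,t')=\beta/t$ for $t'\le t$, $K(t,t')=0$ otherwise, that is, put $z_{v,t}=\frac{\beta}{t}\sum_{t'\le t}x_{v,t'}$. For every vertex $v$ draw $\alpha_v$ independently and uniformly from $[0,1]$, and let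 $\tau(v)$ be the earliest time $t$ with $\sum_{t'\le t}z_{v,t'}\ge\alpha_v$ ($\tau(v)=\infty$ if there is none). Output the vertices in increasing order of $\tau$, ties being broken uniformly at random. The algorithm has approximation ratio at most $\rho$ if on every instance, and for every choice of the optimum LP solution, the expected cost of its output is at most $\rho$ times the minimum cost of an ordering. Let $P$ be a tail bound function: whenever $Y_1,\dots,Y_m$ are independent $\{0,1\}$-valued random variables with $\mathbb E[\sum_i Y_i]=\gamma k$, where $k$ is a positive integer and $\gamma\ge 1$, one has $\Pr[\sum_i Y_i<k]\le P(\gamma)$. **Theorem.** For every $\beta\ge 1$ and every tail bound function $P$ that is convex and non-increasing on $[1,\infty)$ and satisfies $P(1)\le 1$, the algorithm has approximation ratio at most $\beta\, r(\beta)$, where $$r(\beta)=e^{1/\beta}\Bigl(1+\frac1\beta\int_1^\infty P(x)\,e^{(x-1)/\beta}\,dx\Bigr)\in[0,\infty].$$ In particular: 1. $P(\gamma)=e^{1-\gamma}/2$ is such a tail bound function. For it, $\beta r(\beta)=\beta(2\beta-1)e^{1/\beta}/(2\beta-2)$ for every $\beta>1$, so the algorithm has this approximation ratio; the value is at most $4.9102$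 for $\beta=2.191$. 2. $P(\gamma)=e^{-\gamma}(e/2)^{e^{1-\gamma}}$ is such a tail bound function. For it, $\beta r(\beta)\le 4.642$ for $\beta=2.0715$, so the algorithm has approximation ratio at most $4.642$. -/

import Mathlib

open MeasureTheory ProbabilityTheory Set
open scoped ENNReal

/-- An instance of generalized min sum set cover (GMSSC): a finite hypergraph with vertex set `V`,
hyperedges `edge e` indexed by `e : E`, and covering requirements `1 ≤ k e ≤ |edge e|`. -/
structure GMSSC (V E : Type) where
  edge : E → Finset V
  k : E → ℕ
  k_pos : ∀ e, 1 ≤ k e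
  k_le : ∀ e, k e ≤ (edge e).card

/-- An ordering of the vertices: `σ v = i` means that `v` is assigned to time slot `i + 1`. -/
abbrev VertexOrdering (V : Type) [Fintype V] : Type := V ≃ Fin (Fintype.card V)

/-- A fractional schedule: `x v t` is the extent to which `v` is assigned to time slot `t`, and
`u e t` the extent to which `e` is not covered at the start of slot `t`. The time slots are
`t = 1, 2, 3, …`; the values at `t = 0` play no role. -/
structure FracSchedule (V E : Type) where
  x : V → ℕ → ℝ
  u : E → ℕ → ℝ

/-- The kernel `K(t, t') = β / t` for `t' ≤ t`, and `0` otherwise. -/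
noncomputable def kernel (β : ℝ) (t t' : ℕ) : ℝ := if t' ≤ t then β / t else 0

/-- The kernel applied to a vector `a = (a₁, a₂, …)`: `(K a)_t = ∑_{t' ≥ 1} K(t, t') a_{t'}`.
The terms with `t' > t` vanish, so that the sum is over `1 ≤ t' ≤ t`. -/
noncomputable def applyKernel (β : ℝ) (a : ℕ → ℝ) (t : ℕ) : ℝ :=
  ∑ t' ∈ Finset.Icc 1 t, kernel β t t' * a t'

/-- The `α`-point of a vector `z = (z₁, z₂, …)`: the earliest time `t ≥ 1` for which
`∑_{t' ≤ t} z_{t'} ≥ α`; it is `⊤` if there is no such time. -/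
noncomputable def alphaPoint (z : ℕ → ℝ) (α : ℝ) : ℕ∞ :=
  sInf ((fun t : ℕ => (t : ℕ∞)) '' {t : ℕ | 1 ≤ t ∧ α ≤ ∑ t' ∈ Finset.Icc 1 t, z t'})

/-- The ordering that lists the vertices by increasing `key`. -/
noncomputable def orderByKey {V : Type} [Fintype V] {κ : Type} [LinearOrder κ] (key : V → κ)
    (hkey : Function.Injective key) : VertexOrdering V :=
  Equiv.ofBijective
    (fun v => (⟨(Finset.univ.filter fun w => key w < key v).card,
      Finset.card_lt_univ_of_notMem (x := v) (by simp)⟩ : Fin (Fintype.card V)))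
    ((Fintype.bijective_iff_injective_and_card _).2 ⟨by
      have key_lt : ∀ a b : V, key a < key b →
          (Finset.univ.filter fun w => key w < key a).card <
            (Finset.univ.filter fun w => key w < key b).card := by
        intro a b hab
        refine Finset.card_lt_card (Finset.ssubset_iff_of_subset ?_ |>.2 ⟨a, by simpa using hab,
          by simp⟩)
        intro w hw
        simp only [Finset.mem_filter, Finset.mem_univ, true_and] at hw ⊢
        exact hw.trans hab
      intro a b hab
      have hc := congrArg Fin.val hab
      rcases lt_trichotomy (key a) (key b) with h | h | h
      · exact absurd hc (key_lt a b h).ne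
      · exact hkey h
      · exact absurd hc (key_lt b a h).ne', by simp⟩)

/-- The final schedule: vertices are listed by increasing tentative time `τ v`, ties being broken
according to the ordering `ρ` (vertices that `τ` never schedules come last). -/
noncomputable def breakTies {V : Type} [Fintype V] (τ : V → ℕ∞) (ρ : VertexOrdering V) : VertexOrdering V :=
  orderByKey (fun v => (toLex (τ v, ρ v) : ℕ∞ ×ₗ Fin (Fintype.card V))) (by
    intro a b h
    exact ρ.injective (congrArg (fun y => (ofLex y).2) h))

namespace GMSSC

variable {V E : Type} [Fintype V] [DecidableEq V] [Fintype E]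

/-- The cover time of `e`: the earliest time `t` by which `k e` vertices of `e` have appeared. -/
noncomputable def coverTime (I : GMSSC V E) (σ : VertexOrdering V) (e : E) : ℕ :=
  sInf {t : ℕ | I.k e ≤ ((I.edge e).filter fun v => (σ v : ℕ) + 1 ≤ t).card}

/-- The objective: the total cover time of all hyperedges. -/
noncomputable def cost (I : GMSSC V E) (σ : VertexOrdering V) : ℕ := ∑ e, I.coverTime σ e

/-- The minimum cost of an ordering. -/
noncomputable def opt (I : GMSSC V E) : ℕ := ⨅ σ : VertexOrdering V, I.cost σ

/-- The constraints of the LP relaxation with the knapsack cover inequalities. -/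
structure IsFeasible (I : GMSSC V E) (s : FracSchedule V E) : Prop where
  x_nonneg : ∀ v t, 1 ≤ t → 0 ≤ s.x v t
  u_nonneg : ∀ e t, 1 ≤ t → 0 ≤ s.u e t
  packing : ∀ t, 1 ≤ t → ∑ v, s.x v t ≤ 1
  knapsackCover : ∀ e t, 1 ≤ t → ∀ S ⊆ I.edge e, S.card < I.k e →
    ((I.k e : ℝ) - S.card) ≤
      ((I.k e : ℝ) - S.card) * s.u e t +
        ∑ v ∈ I.edge e \ S, ∑ t' ∈ Finset.Ico 1 t, s.x v t'

/-- The objective `∑_{e,t} u_{e,t}` of the LP relaxation, with values in `[0, ∞]`. -/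
noncomputable def lpCost (_I : GMSSC V E) (s : FracSchedule V E) : ℝ≥0∞ :=
  ∑ e, ∑' t : ℕ, ENNReal.ofReal (s.u e (t + 1))

/-- `s` is an optimum solution of the LP relaxation. -/
def IsLPOptimal (I : GMSSC V E) (s : FracSchedule V E) : Prop :=
  I.IsFeasible s ∧ ∀ s', I.IsFeasible s' → I.lpCost s ≤ I.lpCost s'

end GMSSC

/-- The tentative schedule `τ`: the `α_v`-point of `z_v = K x_v` for each vertex `v`. -/
noncomputable def tentative {V E : Type} (β : ℝ) (s : FracSchedule V E) (α : V → ℝ) (v : V) : ℕ∞ :=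
  alphaPoint (applyKernel β (s.x v)) (α v)

/-- The expected cost of the schedule returned by the algorithm when it starts from the fractional
schedule `s`: the `α_v` are independent and uniform on `[0,1]`, and, independently, ties are broken
according to a uniformly random ordering `ρ` of the vertices. -/
noncomputable def GMSSC.expectedCost {V E : Type} [Fintype V] [DecidableEq V] [Fintype E]
    (I : GMSSC V E) (β : ℝ) (s : FracSchedule V E) : ℝ≥0∞ :=
  ∫⁻ α : V → ℝ,
    (∑ ρ : VertexOrdering V, (I.cost (breakTies (tentative β s α) ρ) : ℝ≥0∞)) /
      (Fintype.card (VertexOrdering V) : ℝ≥0∞)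
    ∂(Measure.pi fun _ : V => (volume : Measure ℝ).restrict (Icc 0 1))

/-- The algorithm with the kernel `β / t` has approximation ratio at most `r`: on every instance
the LP relaxation has an optimum solution, and whichever optimum solution the algorithm rounds, the
expected cost of its output is at most `r` times the minimum cost. -/
def HasApproxRatio (β : ℝ) (r : ℝ≥0∞) : Prop :=
  ∀ (V E : Type) [Fintype V] [DecidableEq V] [Fintype E] (I : GMSSC V E),
    (∃ s, I.IsLPOptimal s) ∧
      ∀ s, I.IsLPOptimal s → I.expectedCost β s ≤ r * (I.opt : ℝ≥0∞)

/-- `P` bounds the lower tail of sums of Bernoulli random variables: whenever `Y₁, …, Yₙ` are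
independent `{0,1}`-valued random variables with `𝔼[∑ Yᵢ] = γ k`, where `k` is a positive integer
and `γ ≥ 1`, one has `Pr[∑ Yᵢ < k] ≤ P γ`. -/
def IsTailBound (P : ℝ → ℝ) : Prop :=
  ∀ (Ω : Type) [MeasurableSpace Ω] (μ : Measure Ω) [IsProbabilityMeasure μ]
    (n k : ℕ) (γ : ℝ) (Y : Fin n → Ω → ℝ),
    (∀ i, Measurable (Y i)) → (∀ i ω, Y i ω = 0 ∨ Y i ω = 1) → iIndepFun Y μ →
    1 ≤ k → 1 ≤ γ → ∫ ω, ∑ i, Y i ω ∂μ = γ * k →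
    μ.real {ω | ∑ i, Y i ω < k} ≤ P γ

/-- The tail bound functions to which the analysis applies. -/
structure IsAdmissible (P : ℝ → ℝ) : Prop where
  isTailBound : IsTailBound P
  convex : ConvexOn ℝ (Ici 1) P
  nonincreasing : AntitoneOn P (Ici 1)
  at_one_le : P 1 ≤ 1

/-- `r(β) = e^{1/β} (1 + (1/β) ∫₁^∞ P(x) e^{(x-1)/β} dx)` for a function `P` that is nonnegative on
`[1, ∞)`, as tail bounds are; the value is `∞` if the integral diverges. -/
noncomputable def ratio (P : ℝ → ℝ) (β : ℝ) : ℝ≥0∞ :=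
  ENNReal.ofReal (Real.exp (1 / β)) *
    (1 + ENNReal.ofReal (1 / β) *
      ∫⁻ x in Ioi (1 : ℝ), ENNReal.ofReal (P x * Real.exp ((x - 1) / β)))

/-- The tail bound function `P(γ) = e^{1-γ} / 2`. -/
noncomputable def simpleTail (γ : ℝ) : ℝ := Real.exp (1 - γ) / 2

/-- The tail bound function `P(γ) = e^{-γ} (e/2)^{e^{1-γ}}`. -/
noncomputable def strongTail (γ : ℝ) : ℝ :=
  Real.exp (-γ) * (Real.exp 1 / 2) ^ Real.exp (1 - γ)

/-! The analysis treats one hyperedge e at a time. The kernel gives every slot total mass at most β,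
so at most βt vertices are expected to be tentatively scheduled by time t. Vertices of e whose
accumulated mass has reached 1 are scheduled almost surely; call them S. The knapsack-cover
inequality for S says that the other vertices of e carry mass at least (k_e - |S|) L_t, where L_t =
β ∑_{i ≤ t} (1 - min(u_{e,i+1}, 1))/i is `meanLevel`. So once L_t ≥ 1, e is still uncovered at time
t with probability at most P(L_t) (`thresholdLaw_scheduledCount_lt_le`).

The final cover time is at most k_e plus the number of vertices outside e that are tentatively
scheduled by the time e is covered (`coverTime_breakTies_le`). Thresholds outside e are independent
of those inside. Moreover k_e is paid for by the mass of e itself at the first time m with L_m ≥ 1.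
Hence the expected cover time is at most β ∑_t Q(L_t), where Q is P extended by 1 below 1
(`lintegral_coverBound_le`).

It remains to bound ∑ Q(L_t) by r(β) ∑ u_{e,t}. If u vanishes from time t on, at level g, then in
continuous time dL = β dt/t, and the remaining cost is t F(g) with F(g) = ∫_g^∞ Q(x) e^{(x-g)/β}
dx/β. The potential (N+1) F(L_N) makes this an induction on time with factor F(0) + 1 ≤ r(β)
(`sum_extendedTail_meanLevel_le`). Summing over e and comparing the LP optimum with the best
ordering gives the ratio.

For the explicit tail bounds, Bernoulli summands are replaced one by one by Poisson variables of
equal mean, which only raises the lower tail below the mean. The Poisson tail is at most 1/2 at γ =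
1, and for k ≥ 2 it decays at least like e^{-4(γ-1)/3}, which is enough for `strongTail`.
`simpleTail` dominates `strongTail`. -/

/-! ### Generating functions and the comparison of Bernoulli sums with Poisson variables -/

/-- The probability generating function of a Poisson variable with mean `l`. -/
noncomputable def poissonSeries (l : ℝ) : PowerSeries ℝ :=
  PowerSeries.mk fun j => Real.exp (-l) * l ^ j / (j.factorial : ℝ)

/-- The probability generating function of a Bernoulli variable with mean `p`. -/
noncomputable def bernoulliPoly (p : ℝ) : Polynomial ℝ :=
  Polynomial.C (1 - p) + Polynomial.C p * Polynomial.X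

/-- The probability generating function of the sum of independent Bernoulli variables with means
`p i`, `i ∈ s`, and of a Poisson variable with mean `l`. -/
noncomputable def mixSeries {ι : Type*} (p : ι → ℝ) (s : Finset ι) (l : ℝ) : PowerSeries ℝ :=
  ((∏ i ∈ s, bernoulliPoly (p i) : Polynomial ℝ) : PowerSeries ℝ) * poissonSeries l

lemma coeff_bernoulliPoly_mul (q : ℝ) (W : PowerSeries ℝ) (k : ℕ) :
    PowerSeries.coeff k ((bernoulliPoly q : PowerSeries ℝ) * W) =
      (1 - q) * PowerSeries.coeff k W + q * PowerSeries.coeff k (PowerSeries.X * W) := by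
  rw [bernoulliPoly, Polynomial.coe_add, Polynomial.coe_mul, Polynomial.coe_C, Polynomial.coe_C,
    Polynomial.coe_X, add_mul, mul_assoc, map_add, PowerSeries.coeff_C_mul,
    PowerSeries.coeff_C_mul]

lemma derivative_poissonSeries (l : ℝ) :
    PowerSeries.derivative ℝ (poissonSeries l) = PowerSeries.C l * poissonSeries l := by
  ext k
  rw [PowerSeries.coeff_derivative]
  simp only [poissonSeries, PowerSeries.coeff_mk, PowerSeries.coeff_C_mul]
  have h : ((k.factorial : ℝ)) ≠ 0 := by positivity
  rw [Nat.factorial_succ]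
  push_cast
  field_simp
  ring

/-- The series is formally e^{l(X-1)}, so differentiating in l multiplies it by X - 1. -/
lemma hasDerivAt_coeff_poissonSeries (l : ℝ) (k : ℕ) :
    HasDerivAt (fun l => PowerSeries.coeff k (poissonSeries l))
      (PowerSeries.coeff k ((PowerSeries.X - 1) * poissonSeries l)) l := by
  have he : HasDerivAt (fun l : ℝ => Real.exp (-l)) (Real.exp (-l) * -1) l :=
    (hasDerivAt_neg l).exp
  have h := (he.mul (hasDerivAt_pow k l)).div_const (k.factorial : ℝ)
  rw [sub_mul, one_mul, map_sub]
  simp only [poissonSeries, PowerSeries.coeff_mk]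
  refine h.congr_deriv ?_
  cases k with
  | zero => simp
  | succ k =>
    rw [PowerSeries.coeff_succ_X_mul, PowerSeries.coeff_mk, Nat.factorial_succ]
    have h : ((k.factorial : ℝ)) ≠ 0 := by positivity
    push_cast
    field_simp
    ring_nf

lemma hasDerivAt_coeff_mixSeries {ι : Type*} (p : ι → ℝ) (s : Finset ι) (l : ℝ) (k : ℕ) :
    HasDerivAt (fun l => PowerSeries.coeff k (mixSeries p s l))
      (PowerSeries.coeff k ((PowerSeries.X - 1) * mixSeries p s l)) l := by
  have h : (PowerSeries.X - 1) * mixSeries p s l =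
      ((∏ i ∈ s, bernoulliPoly (p i) : Polynomial ℝ) : PowerSeries ℝ) *
        ((PowerSeries.X - 1) * poissonSeries l) := by rw [mixSeries]; ring
  rw [h]
  simp only [mixSeries]
  rw [PowerSeries.coeff_mul]
  simp only [PowerSeries.coeff_mul k]
  exact HasDerivAt.fun_sum fun x _ => (hasDerivAt_coeff_poissonSeries l x.2).const_mul _

section mix

variable {ι : Type*} [DecidableEq ι] (p : ι → ℝ)

lemma mixSeries_eq_mul_erase (s : Finset ι) (l : ℝ) {i : ι} (hi : i ∈ s) :
    mixSeries p s l = (bernoulliPoly (p i) : PowerSeries ℝ) * mixSeries p (s.erase i) l := by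
  rw [mixSeries, ← Finset.mul_prod_erase s _ hi, Polynomial.coe_mul, mixSeries, mul_assoc]

lemma mixSeries_insert (s : Finset ι) (l : ℝ) {i : ι} (hi : i ∉ s) :
    mixSeries p (insert i s) l = (bernoulliPoly (p i) : PowerSeries ℝ) * mixSeries p s l := by
  rw [mixSeries, Finset.prod_insert hi, Polynomial.coe_mul, mixSeries, mul_assoc]

lemma derivative_mixSeries (s : Finset ι) (l : ℝ) :
    PowerSeries.derivative ℝ (mixSeries p s l) =
      ∑ i ∈ s, PowerSeries.C (p i) * mixSeries p (s.erase i) l +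
        PowerSeries.C l * mixSeries p s l := by
  have h : ∀ i, Polynomial.derivative (bernoulliPoly (p i)) = Polynomial.C (p i) := by
    intro i
    simp [bernoulliPoly]
  rw [mixSeries, Derivation.leibniz, PowerSeries.derivative_coe,
    Polynomial.derivative_prod_finset, derivative_poissonSeries]
  simp only [h, smul_eq_mul, mixSeries]
  have hc : ∀ f : ι → Polynomial ℝ,
      ((∑ i ∈ s, f i : Polynomial ℝ) : PowerSeries ℝ) = ∑ i ∈ s, (f i : PowerSeries ℝ) :=
    fun f => map_sum Polynomial.coeToPowerSeries.ringHom f s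
  rw [hc, Finset.mul_sum]
  simp only [Polynomial.coe_mul, Polynomial.coe_C]
  rw [add_comm]
  congr 1
  · exact Finset.sum_congr rfl fun i _ => by ring
  · ring

lemma coeff_mixSeries_nonneg {s : Finset ι} {l : ℝ} (hp : ∀ i ∈ s, 0 ≤ p i ∧ p i ≤ 1)
    (hl : 0 ≤ l) (k : ℕ) : 0 ≤ PowerSeries.coeff k (mixSeries p s l) := by
  induction s using Finset.induction_on generalizing k with
  | empty => simp only [mixSeries, Finset.prod_empty, Polynomial.coe_one, one_mul, poissonSeries,
      PowerSeries.coeff_mk]; positivity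
  | insert a s ha ih =>
    have hs : ∀ i ∈ s, 0 ≤ p i ∧ p i ≤ 1 := fun i hi => hp i (Finset.mem_insert_of_mem hi)
    obtain ⟨h0, h1⟩ := hp a (Finset.mem_insert_self a s)
    rw [mixSeries_insert p s l ha, coeff_bernoulliPoly_mul]
    refine add_nonneg (mul_nonneg (by linarith) (ih hs k)) (mul_nonneg h0 ?_)
    cases k with
    | zero => simp
    | succ k => rw [PowerSeries.coeff_succ_X_mul]; exact ih hs k

/-- Below its mean, the distribution of a sum of independent Bernoulli and Poisson variables is
nondecreasing. -/
lemma coeff_X_mul_mixSeries_le {s : Finset ι} {l : ℝ} (hp : ∀ i ∈ s, 0 ≤ p i ∧ p i ≤ 1)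
    (hl : 0 ≤ l) (k : ℕ) (hk : (k : ℝ) ≤ l + ∑ i ∈ s, p i) :
    PowerSeries.coeff k (PowerSeries.X * mixSeries p s l) ≤
      PowerSeries.coeff k (mixSeries p s l) := by
  induction k generalizing s with
  | zero => simpa using coeff_mixSeries_nonneg p hp hl 0
  | succ k ih =>
    rw [PowerSeries.coeff_succ_X_mul]
    set c := PowerSeries.coeff k (mixSeries p s l) with hc
    have hc0 : 0 ≤ c := coeff_mixSeries_nonneg p hp hl k
    -- Reading off a coefficient of the X-derivative turns the product rule into a recursion for the
    -- point probabilities.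
    have h1 : PowerSeries.coeff (k + 1) (mixSeries p s l) * (k + 1) =
        ∑ i ∈ s, p i * PowerSeries.coeff k (mixSeries p (s.erase i) l) + l * c := by
      rw [← PowerSeries.coeff_derivative, derivative_mixSeries]
      simp [hc]
    have h2 : ∀ i ∈ s, p i * c ≤ p i * PowerSeries.coeff k (mixSeries p (s.erase i) l) := by
      intro i hi
      obtain ⟨hi0, hi1⟩ := hp i hi
      refine mul_le_mul_of_nonneg_left ?_ hi0
      have h3 : PowerSeries.coeff k (PowerSeries.X * mixSeries p (s.erase i) l) ≤
          PowerSeries.coeff k (mixSeries p (s.erase i) l) := by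
        -- Removing one summand lowers the mean by `p i ≤ 1`, so `k` is still below it.
        refine ih (fun j hj => hp j (Finset.mem_of_mem_erase hj)) ?_
        have := Finset.add_sum_erase s p hi
        push_cast at hk
        linarith
      rw [hc, mixSeries_eq_mul_erase p s l hi, coeff_bernoulliPoly_mul]
      nlinarith
    have h3 := Finset.sum_le_sum h2
    rw [← Finset.sum_mul] at h3
    push_cast at hk
    have h4 : c * (k + 1) ≤ PowerSeries.coeff (k + 1) (mixSeries p s l) * (k + 1) := by
      rw [h1]; nlinarith
    exact le_of_mul_le_mul_right h4 (by positivity)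

/-- Multiplication by X - 1 takes differences of consecutive coefficients, and the sum telescopes.
-/
lemma sum_coeff_X_sub_one_mul (V : PowerSeries ℝ) (k : ℕ) :
    ∑ j ∈ Finset.range (k + 1), PowerSeries.coeff j ((PowerSeries.X - 1) * V) =
      - PowerSeries.coeff k V := by
  induction k with
  | zero => simp [sub_mul]
  | succ k ih => rw [Finset.sum_range_succ, ih, sub_mul, one_mul, map_sub,
      PowerSeries.coeff_succ_X_mul]; ring

/-- Replacing a Bernoulli summand by a Poisson one of the same mean increases the lower tail. -/
lemma sum_coeff_bernoulliPoly_mul_le {s : Finset ι} {l q : ℝ}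
    (hp : ∀ i ∈ s, 0 ≤ p i ∧ p i ≤ 1) (hl : 0 ≤ l) (hq0 : 0 ≤ q) (hq1 : q ≤ 1) (k : ℕ)
    (hk : (k : ℝ) + 1 ≤ l + q + ∑ i ∈ s, p i) :
    ∑ j ∈ Finset.range (k + 1),
        PowerSeries.coeff j ((bernoulliPoly q : PowerSeries ℝ) * mixSeries p s l) ≤
      ∑ j ∈ Finset.range (k + 1), PowerSeries.coeff j (mixSeries p s (l + q)) := by
  -- Mean `x` is moved continuously from the Bernoulli to the Poisson part. As the Bernoulli factor
  -- is 1 + (q-x)(X-1), the product has derivative (q-x)(X-1)² W, and summing coefficients leaves a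
  -- single difference of point probabilities of W.
  set H : ℝ → ℝ := fun x => ∑ j ∈ Finset.range (k + 1), PowerSeries.coeff j
    ((bernoulliPoly (q - x) : PowerSeries ℝ) * mixSeries p s (l + x)) with hH
  have hder : ∀ x, HasDerivAt H ((q - x) * (PowerSeries.coeff k (mixSeries p s (l + x)) -
      PowerSeries.coeff k (PowerSeries.X * mixSeries p s (l + x)))) x := by
    intro x
    set W := mixSeries p s (l + x) with hW
    have hd : ∀ j, HasDerivAt (fun x => PowerSeries.coeff j (mixSeries p s (l + x)))
        (PowerSeries.coeff j ((PowerSeries.X - 1) * W)) x := by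
      intro j
      simpa using (hasDerivAt_coeff_mixSeries p s (l + x) j).comp_const_add l x
    have hdX : ∀ j, HasDerivAt
        (fun x => PowerSeries.coeff j (PowerSeries.X * mixSeries p s (l + x)))
        (PowerSeries.coeff j (PowerSeries.X * ((PowerSeries.X - 1) * W))) x := by
      intro j
      cases j with
      | zero => simpa using hasDerivAt_const x (0 : ℝ)
      | succ j => simp only [PowerSeries.coeff_succ_X_mul]; exact hd j
    have hqx : HasDerivAt (fun x => q - x) (-1) x := by
      simpa using (hasDerivAt_id x).const_sub q
    have hqx' : HasDerivAt (fun x => 1 - (q - x)) 1 x := by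
      simpa using hqx.const_sub 1
    have hterm : ∀ j, HasDerivAt (fun x => PowerSeries.coeff j
        ((bernoulliPoly (q - x) : PowerSeries ℝ) * mixSeries p s (l + x)))
        ((q - x) * PowerSeries.coeff j ((PowerSeries.X - 1) * ((PowerSeries.X - 1) * W))) x := by
      intro j
      simp only [coeff_bernoulliPoly_mul]
      refine ((hqx'.mul (hd j)).add (hqx.mul (hdX j))).congr_deriv ?_
      simp only [sub_mul, one_mul, mul_sub, map_sub, ← hW]
      ring
    refine (HasDerivAt.fun_sum fun j _ => hterm j).congr_deriv ?_
    rw [← Finset.mul_sum, sum_coeff_X_sub_one_mul, sub_mul _ _ W, one_mul, map_sub]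
    ring
  have hmono : MonotoneOn H (Icc 0 q) := by
    refine monotoneOn_of_deriv_nonneg (convex_Icc 0 q)
      (fun x _ => (hder x).continuousAt.continuousWithinAt)
      (fun x _ => (hder x).differentiableAt.differentiableWithinAt) ?_
    intro x hx
    rw [interior_Icc] at hx
    rw [(hder x).deriv]
    refine mul_nonneg (by linarith [hx.2]) (sub_nonneg.2 ?_)
    -- W lacks the Bernoulli variable; since `q ≤ 1`, its mean is still at least `k`.
    exact coeff_X_mul_mixSeries_le p hp (by linarith [hx.1]) k (by linarith [hx.1])
  have h := hmono (left_mem_Icc.2 hq0) (right_mem_Icc.2 hq0) hq0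
  simpa [hH, bernoulliPoly] using h

lemma sum_coeff_mixSeries_le {s : Finset ι} {l : ℝ}
    (hp : ∀ i ∈ s, 0 ≤ p i ∧ p i ≤ 1) (hl : 0 ≤ l) (k : ℕ)
    (hk : (k : ℝ) + 1 ≤ l + ∑ i ∈ s, p i) :
    ∑ j ∈ Finset.range (k + 1), PowerSeries.coeff j (mixSeries p s l) ≤
      ∑ j ∈ Finset.range (k + 1), PowerSeries.coeff j (poissonSeries (l + ∑ i ∈ s, p i)) := by
  induction s using Finset.induction_on generalizing l with
  | empty => simp [mixSeries]
  | insert a s ha ih =>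
    have hs : ∀ i ∈ s, 0 ≤ p i ∧ p i ≤ 1 := fun i hi => hp i (Finset.mem_insert_of_mem hi)
    obtain ⟨h0, h1⟩ := hp a (Finset.mem_insert_self a s)
    rw [Finset.sum_insert ha, ← add_assoc] at hk ⊢
    rw [mixSeries_insert p s l ha]
    exact (sum_coeff_bernoulliPoly_mul_le p hs hl h0 h1 k hk).trans
      (ih hs (add_nonneg hl h0) hk)

/-- Above `k + 1`, the lower tail of a sum of independent Bernoulli variables is dominated by that
of the Poisson variable of the same mean. -/
lemma sum_coeff_prod_bernoulliPoly_le {s : Finset ι}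
    (hp : ∀ i ∈ s, 0 ≤ p i ∧ p i ≤ 1) (k : ℕ) (hk : (k : ℝ) + 1 ≤ ∑ i ∈ s, p i) :
    ∑ j ∈ Finset.range (k + 1), (∏ i ∈ s, bernoulliPoly (p i)).coeff j ≤
      ∑ j ∈ Finset.range (k + 1),
        Real.exp (-∑ i ∈ s, p i) * (∑ i ∈ s, p i) ^ j / (j.factorial : ℝ) := by
  have h0 : poissonSeries 0 = 1 := by
    ext j
    rw [poissonSeries, PowerSeries.coeff_mk, PowerSeries.coeff_one]
    split_ifs with hj <;> simp [hj]
  have h := sum_coeff_mixSeries_le p hp le_rfl k (by simpa using hk)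
  rw [mixSeries, h0, mul_one, zero_add] at h
  simpa [poissonSeries] using h

end mix

/-! ### The lower tail of the Poisson distribution -/

/-- With K = k + 1, equality holds at i = 0. Passing to i + 1 multiplies the left side by (K-i-1)/K
and the right side by K/(K+i+1), and (K-i-1)(K+i+1) ≤ K². -/
lemma pow_div_factorial_reflect_le (k i : ℕ) (hi : i ≤ k) :
    ((k : ℝ) + 1) ^ (k - i) / ((k - i).factorial : ℝ) ≤
      ((k : ℝ) + 1) ^ (k + 1 + i) / ((k + 1 + i).factorial : ℝ) := by
  induction i with
  | zero =>
    have h : ((k.factorial : ℝ)) ≠ 0 := by positivity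
    simp only [Nat.sub_zero, Nat.add_zero, Nat.factorial_succ]
    push_cast
    apply le_of_eq
    field_simp
    ring
  | succ i ih =>
    obtain ⟨d, rfl⟩ := Nat.exists_eq_add_of_le hi
    have h1 : i + 1 + d - i = d + 1 := by omega
    have h2 : i + 1 + d - (i + 1) = d := by omega
    have ih := ih (by omega)
    rw [h1] at ih
    rw [h2]
    set K : ℝ := ((i + 1 + d : ℕ) : ℝ) + 1 with hK
    have hK' : K = i + 1 + d + 1 := by rw [hK]; push_cast; ring
    have hK0 : 0 < K := by rw [hK]; positivity
    have e1 : K ^ d / (d.factorial : ℝ) =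
        K ^ (d + 1) / ((d + 1).factorial : ℝ) * ((d + 1) / K) := by
      have h : ((d.factorial : ℝ)) ≠ 0 := by positivity
      rw [Nat.factorial_succ]; push_cast; field_simp; ring
    have e2 : K ^ (i + 1 + d + 1 + (i + 1)) / ((i + 1 + d + 1 + (i + 1)).factorial : ℝ) =
        K ^ (i + 1 + d + 1 + i) / ((i + 1 + d + 1 + i).factorial : ℝ) * (K / (K + i + 1)) := by
      have h : (((i + 1 + d + 1 + i).factorial : ℝ)) ≠ 0 := by positivity
      have h' : K + i + 1 = ((i + 1 + d + 1 + i + 1 : ℕ) : ℝ) := by rw [hK']; push_cast; ring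
      rw [← add_assoc, Nat.factorial_succ, pow_succ, h']; push_cast; field_simp
    rw [e1, e2]
    refine mul_le_mul ih ?_ (by positivity) (by positivity)
    rw [div_le_div_iff₀ hK0 (by positivity), hK']
    have : (0 : ℝ) ≤ i := by positivity
    have : (0 : ℝ) ≤ d := by positivity
    nlinarith

/-- A Poisson variable with mean `k + 1` is at most `k` with probability at most `1 / 2`. -/
lemma poisson_median_le (k : ℕ) :
    ∑ j ∈ Finset.range (k + 1), Real.exp (-((k : ℝ) + 1)) * ((k : ℝ) + 1) ^ j / (j.factorial : ℝ) ≤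
      1 / 2 := by
  set a : ℕ → ℝ := fun j => ((k : ℝ) + 1) ^ j / (j.factorial : ℝ) with ha
  -- Terms are paired by reflection about k + 1/2; both blocks together are part of the exponential
  -- series.
  have h1 : ∑ j ∈ Finset.range (k + 1), a j ≤ ∑ j ∈ Finset.range (k + 1), a (k + 1 + j) := by
    rw [← Finset.sum_range_reflect]
    refine Finset.sum_le_sum fun i hi => ?_
    rw [Finset.mem_range] at hi
    exact pow_div_factorial_reflect_le k i (by omega)
  have h2 : ∑ j ∈ Finset.range (k + 1), a j + ∑ j ∈ Finset.range (k + 1), a (k + 1 + j) ≤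
      Real.exp ((k : ℝ) + 1) := by
    rw [← Finset.sum_range_add]
    exact Real.sum_le_exp_of_nonneg (by positivity) _
  have h3 : ∑ j ∈ Finset.range (k + 1),
      Real.exp (-((k : ℝ) + 1)) * ((k : ℝ) + 1) ^ j / (j.factorial : ℝ) =
      Real.exp (-((k : ℝ) + 1)) * ∑ j ∈ Finset.range (k + 1), a j := by
    rw [Finset.mul_sum]
    exact Finset.sum_congr rfl fun j _ => mul_div_assoc _ _ _
  rw [h3, Real.exp_neg]
  have h4 := Real.exp_pos ((k : ℝ) + 1)
  rw [inv_mul_le_iff₀ h4]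
  linarith

/-- Going down from index k the terms shrink at least as fast as the arithmetic progression 1 -
i/(k+1), whose sum is (k+2)/2. -/
lemma sum_pow_div_factorial_le (k : ℕ) {m : ℝ} (hm : (k : ℝ) + 1 ≤ m) :
    ∑ j ∈ Finset.range (k + 1), m ^ j / (j.factorial : ℝ) ≤
      ((k : ℝ) + 2) / 2 * (m ^ k / (k.factorial : ℝ)) := by
  have hk1 : (0 : ℝ) < (k : ℝ) + 1 := by positivity
  have hm0 : 0 < m := hk1.trans_le hm
  set A : ℝ := m ^ k / (k.factorial : ℝ) with hA
  have hA0 : 0 ≤ A := by positivity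
  have h : ∀ i, i ≤ k → m ^ (k - i) / ((k - i).factorial : ℝ) ≤ A * (1 - i / ((k : ℝ) + 1)) := by
    intro i
    induction i with
    | zero => intro _; simp [hA]
    | succ i ih =>
      intro hi
      obtain ⟨d, rfl⟩ := Nat.exists_eq_add_of_le hi
      have h1 : i + 1 + d - i = d + 1 := by omega
      have h2 : i + 1 + d - (i + 1) = d := by omega
      have ih := ih (by omega)
      rw [h1] at ih
      rw [h2]
      have e1 : m ^ d / (d.factorial : ℝ) =
          m ^ (d + 1) / ((d + 1).factorial : ℝ) * ((d + 1) / m) := by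
        have h : ((d.factorial : ℝ)) ≠ 0 := by positivity
        rw [Nat.factorial_succ]; push_cast; field_simp; ring
      push_cast at *
      have h5 : m ^ (d + 1) / ((d + 1).factorial : ℝ) ≤ A := by
        refine ih.trans (mul_le_of_le_one_right hA0 ?_)
        linarith [show (0 : ℝ) ≤ i / ((i : ℝ) + 1 + d + 1) by positivity]
      rw [e1]
      refine mul_le_mul h5 ?_ (by positivity) hA0
      rw [one_sub_div hk1.ne', div_le_div_iff₀ hm0 hk1]
      have : (0 : ℝ) ≤ d := by positivity
      nlinarith
  have hs : ∀ n : ℕ, ∑ i ∈ Finset.range (n + 1), (1 - (i : ℝ) / ((k : ℝ) + 1)) =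
      (n + 1) - n * (n + 1) / 2 / ((k : ℝ) + 1) := by
    intro n
    induction n with
    | zero => simp
    | succ n ih => rw [Finset.sum_range_succ, ih]; push_cast; field_simp; ring
  rw [← Finset.sum_range_reflect]
  calc _ ≤ ∑ i ∈ Finset.range (k + 1), A * (1 - i / ((k : ℝ) + 1)) := by
        refine Finset.sum_le_sum fun i hi => ?_
        rw [Finset.mem_range] at hi
        have := h i (by omega)
        simpa using this
    _ = _ := by
        rw [← Finset.mul_sum, hs]
        field_simp
        ring

lemma hasDerivAt_poisson_sum (k : ℕ) (m : ℝ) :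
    HasDerivAt (fun m : ℝ => ∑ j ∈ Finset.range (k + 1),
        Real.exp (-m) * m ^ j / (j.factorial : ℝ))
      (-(Real.exp (-m) * m ^ k / (k.factorial : ℝ))) m := by
  have h := HasDerivAt.fun_sum (u := Finset.range (k + 1))
    fun j _ => hasDerivAt_coeff_poissonSeries m j
  rw [sum_coeff_X_sub_one_mul] at h
  simpa [poissonSeries] using h

lemma strongTail_eq (g : ℝ) :
    strongTail g = Real.exp (-g + (1 - Real.log 2) * Real.exp (1 - g)) := by
  have h : Real.exp 1 / 2 = Real.exp (1 - Real.log 2) := by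
    rw [Real.exp_sub, Real.exp_log (by norm_num)]
  rw [strongTail, h, ← Real.exp_mul, ← Real.exp_add]

lemma log_two_lt_one : Real.log 2 < 1 := by
  linarith [Real.log_two_lt_d9]

/-- A Poisson variable with mean `g (k + 1)` is at most `k` with probability at most
`strongTail g`. -/
lemma poisson_sum_le_strongTail (k : ℕ) {g : ℝ} (hg : 1 ≤ g) :
    ∑ j ∈ Finset.range (k + 1),
        Real.exp (-(g * ((k : ℝ) + 1))) * (g * ((k : ℝ) + 1)) ^ j / (j.factorial : ℝ) ≤
      strongTail g := by
  rw [strongTail_eq]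
  -- For `k = 0` the tail is exactly e^{-g}; the decay rate 4/3 used below needs `k ≥ 1`.
  rcases Nat.eq_zero_or_pos k with rfl | hk
  · have : 0 ≤ (1 - Real.log 2) * Real.exp (1 - g) :=
      mul_nonneg (by linarith [log_two_lt_one]) (Real.exp_pos _).le
    simpa using this
  have hk' : (1 : ℝ) ≤ k := by exact_mod_cast hk
  set G : ℝ → ℝ := fun m => ∑ j ∈ Finset.range (k + 1),
    Real.exp (-m) * m ^ j / (j.factorial : ℝ) with hG
  -- The claim is that the tail decays at rate at least 4/3 in x: its derivative in the mean is
  -- minus the point probability at k, which is at least 4/(3(k+1)) times the tail because (k+2)/2 ≤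
  -- (3/4)(k+1).
  set h : ℝ → ℝ := fun x => G (x * ((k : ℝ) + 1)) * Real.exp (4 / 3 * (x - 1)) with hh
  have hder : ∀ x, HasDerivAt h
      (-(Real.exp (-(x * ((k : ℝ) + 1))) * (x * ((k : ℝ) + 1)) ^ k / (k.factorial : ℝ)) *
          ((k : ℝ) + 1) * Real.exp (4 / 3 * (x - 1)) +
        G (x * ((k : ℝ) + 1)) * (Real.exp (4 / 3 * (x - 1)) * (4 / 3))) x := by
    intro x
    have h1 : HasDerivAt (fun x : ℝ => x * ((k : ℝ) + 1)) ((k : ℝ) + 1) x := by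
      simpa using (hasDerivAt_id x).mul_const ((k : ℝ) + 1)
    have h2 : HasDerivAt (fun x : ℝ => 4 / 3 * (x - 1)) (4 / 3) x := by
      simpa using ((hasDerivAt_id x).sub_const 1).const_mul (4 / 3)
    exact ((hasDerivAt_poisson_sum k (x * ((k : ℝ) + 1))).comp x h1).mul h2.exp
  have hanti : AntitoneOn h (Ici 1) := by
    refine antitoneOn_of_deriv_nonpos (convex_Ici 1)
      (fun x _ => (hder x).continuousAt.continuousWithinAt)
      (fun x _ => (hder x).differentiableAt.differentiableWithinAt) ?_
    intro x hx
    rw [interior_Ici, mem_Ioi] at hx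
    rw [(hder x).deriv]
    set m := x * ((k : ℝ) + 1) with hm
    have hm1 : (k : ℝ) + 1 ≤ m := by rw [hm]; nlinarith
    have hA0 : 0 ≤ m ^ k / (k.factorial : ℝ) := by
      have : 0 ≤ m := by linarith
      positivity
    have h1 : G m ≤ 3 / 4 * ((k : ℝ) + 1) *
        (Real.exp (-m) * m ^ k / (k.factorial : ℝ)) := by
      have h2 : G m = Real.exp (-m) * ∑ j ∈ Finset.range (k + 1), m ^ j / (j.factorial : ℝ) := by
        rw [hG, Finset.mul_sum]
        exact Finset.sum_congr rfl fun j _ => mul_div_assoc _ _ _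
      have h3 : ∑ j ∈ Finset.range (k + 1), m ^ j / (j.factorial : ℝ) ≤
          3 / 4 * ((k : ℝ) + 1) * (m ^ k / (k.factorial : ℝ)) :=
        (sum_pow_div_factorial_le k hm1).trans
          (mul_le_mul_of_nonneg_right (by linarith) hA0)
      rw [h2]
      calc _ ≤ Real.exp (-m) * (3 / 4 * ((k : ℝ) + 1) * (m ^ k / (k.factorial : ℝ))) :=
            mul_le_mul_of_nonneg_left h3 (Real.exp_pos _).le
        _ = _ := by ring
    have h4 := Real.exp_pos (4 / 3 * (x - 1))
    nlinarith
  have h1 : h g ≤ 1 / 2 := by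
    refine (hanti (mem_Ici.2 le_rfl) (mem_Ici.2 hg) hg).trans ?_
    simpa [hh, hG] using poisson_median_le k
  have h2 : G (g * ((k : ℝ) + 1)) ≤ 1 / 2 * Real.exp (-(4 / 3 * (g - 1))) := by
    rw [Real.exp_neg, ← div_eq_mul_inv, le_div_iff₀ (Real.exp_pos _)]
    exact h1
  refine h2.trans ?_
  have h3 : (1 / 2 : ℝ) = Real.exp (-Real.log 2) := by
    rw [Real.exp_neg, Real.exp_log (by norm_num)]; norm_num
  rw [h3, ← Real.exp_add, Real.exp_le_exp]
  -- By this tangent line the exponent of `strongTail` is at least -log 2 - (2 - log 2)(g-1), and 2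
  -- - log 2 ≤ 4/3.
  have h5 : (1 - g) + 1 ≤ Real.exp (1 - g) := Real.add_one_le_exp _
  have h6 := Real.log_two_gt_d9
  nlinarith [log_two_lt_one]

/-! ### Sums of independent Bernoulli variables -/

lemma coeff_zero_bernoulliPoly_mul (q : ℝ) (W : Polynomial ℝ) :
    (bernoulliPoly q * W).coeff 0 = (1 - q) * W.coeff 0 := by
  simp [bernoulliPoly, add_mul, mul_assoc]

lemma coeff_succ_bernoulliPoly_mul (q : ℝ) (W : Polynomial ℝ) (k : ℕ) :
    (bernoulliPoly q * W).coeff (k + 1) = (1 - q) * W.coeff (k + 1) + q * W.coeff k := by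
  rw [bernoulliPoly, add_mul, mul_assoc, Polynomial.coeff_add, Polynomial.coeff_C_mul,
    Polynomial.coeff_C_mul, Polynomial.coeff_X_mul]

lemma exists_natCast_eq_sum {Ω ι : Type*} {Y : ι → Ω → ℝ}
    (hY : ∀ i ω, Y i ω = 0 ∨ Y i ω = 1) (s : Finset ι) (ω : Ω) :
    ∃ j : ℕ, ∑ i ∈ s, Y i ω = j := by
  refine ⟨∑ i ∈ s, if Y i ω = 1 then 1 else 0, ?_⟩
  push_cast
  refine Finset.sum_congr rfl fun i _ => ?_
  rcases hY i ω with h | h <;> simp [h]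

section prob

variable {Ω ι : Type*} [MeasurableSpace Ω] {μ : Measure Ω} [IsProbabilityMeasure μ]
  {Y : ι → Ω → ℝ}

/-- Conditioning on the value of one more variable reproduces the coefficient rule for
multiplication by a Bernoulli factor. -/
lemma measureReal_sum_eq_coeff [DecidableEq ι] (hm : ∀ i, Measurable (Y i))
    (hY : ∀ i ω, Y i ω = 0 ∨ Y i ω = 1) (hi : iIndepFun Y μ) (s : Finset ι) (j : ℕ) :
    μ.real {ω | ∑ i ∈ s, Y i ω = j} =
      (∏ i ∈ s, bernoulliPoly (μ.real {ω | Y i ω = 1})).coeff j := by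
  induction s using Finset.induction_on generalizing j with
  | empty =>
    rw [Finset.prod_empty, Polynomial.coeff_one]
    rcases Nat.eq_zero_or_pos j with rfl | hj
    · simp
    · have : (0 : ℝ) ≠ j := by exact_mod_cast hj.ne
      simp [this, hj.ne']
  | insert a s ha ih =>
    have hind : IndepFun (∑ i ∈ s, Y i) (Y a) μ := hi.indepFun_finsetSum_of_notMem hm ha
    have hmul : ∀ x y : ℝ, μ.real ({ω | ∑ i ∈ s, Y i ω = x} ∩ {ω | Y a ω = y}) =
        μ.real {ω | ∑ i ∈ s, Y i ω = x} * μ.real {ω | Y a ω = y} := by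
      intro x y
      have h := hind.measure_inter_preimage_eq_mul {x} {y} (measurableSet_singleton x)
        (measurableSet_singleton y)
      simp only [measureReal_def]
      rw [← ENNReal.toReal_mul]
      convert congrArg ENNReal.toReal h using 4 <;> ext ω <;> simp
    have hms : ∀ y : ℝ, MeasurableSet {ω | Y a ω = y} := fun y =>
      hm a (measurableSet_singleton y)
    have h0 : μ.real {ω | Y a ω = 0} = 1 - μ.real {ω | Y a ω = 1} := by
      rw [← probReal_compl_eq_one_sub (hms 1)]
      congr 1
      ext ω
      rcases hY a ω with h | h <;> simp [h]
    have hsplit : ∀ x : ℝ, {ω | ∑ i ∈ insert a s, Y i ω = x} =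
        ({ω | ∑ i ∈ s, Y i ω = x} ∩ {ω | Y a ω = 0}) ∪
          ({ω | ∑ i ∈ s, Y i ω = x - 1} ∩ {ω | Y a ω = 1}) := by
      intro x
      ext ω
      simp only [mem_ofPred_eq, mem_union, mem_inter_iff, Finset.sum_insert ha]
      rcases hY a ω with h | h
      · simp [h]
      · simp only [h, one_ne_zero, and_false, and_true, false_or]
        constructor <;> intro h' <;> linarith
    have hms' : ∀ x : ℝ, MeasurableSet {ω | ∑ i ∈ s, Y i ω = x} := fun x =>
      (Finset.measurable_fun_sum s fun i _ => hm i) (measurableSet_singleton x)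
    have hdisj : ∀ x : ℝ, Disjoint ({ω | ∑ i ∈ s, Y i ω = x} ∩ {ω | Y a ω = 0})
        ({ω | ∑ i ∈ s, Y i ω = x - 1} ∩ {ω | Y a ω = 1}) := by
      intro x
      refine Set.disjoint_left.2 fun ω h1 h2 => ?_
      have e1 : Y a ω = 0 := h1.2
      have e2 : Y a ω = 1 := h2.2
      rw [e1] at e2
      exact zero_ne_one e2
    rw [hsplit, measureReal_union (hdisj _) ((hms' _).inter (hms 1)), hmul, hmul, h0,
      Finset.prod_insert ha, ih]
    cases j with
    | zero =>
      have he : {ω | ∑ i ∈ s, Y i ω = ((0 : ℕ) : ℝ) - 1} = ∅ := by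
        ext ω
        simp only [mem_ofPred_eq, mem_empty_iff_false, iff_false]
        obtain ⟨j, hj⟩ := exists_natCast_eq_sum hY s ω
        rw [hj]
        have : (0 : ℝ) ≤ j := by positivity
        push_cast
        intro h
        linarith
      rw [he, coeff_zero_bernoulliPoly_mul]
      simp
      ring
    | succ j =>
      have he : (((j + 1 : ℕ) : ℝ) - 1) = j := by push_cast; ring
      rw [he, ih, coeff_succ_bernoulliPoly_mul]
      ring

lemma measureReal_sum_lt_eq [DecidableEq ι] (hm : ∀ i, Measurable (Y i))
    (hY : ∀ i ω, Y i ω = 0 ∨ Y i ω = 1) (hi : iIndepFun Y μ) (s : Finset ι) (k : ℕ) :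
    μ.real {ω | ∑ i ∈ s, Y i ω < k} =
      ∑ j ∈ Finset.range k, (∏ i ∈ s, bernoulliPoly (μ.real {ω | Y i ω = 1})).coeff j := by
  have h : {ω | ∑ i ∈ s, Y i ω < k} = ⋃ j ∈ Finset.range k, {ω | ∑ i ∈ s, Y i ω = (j : ℝ)} := by
    ext ω
    obtain ⟨j, hj⟩ := exists_natCast_eq_sum hY s ω
    simp [hj]
  rw [h, measureReal_biUnion_finset]
  · exact Finset.sum_congr rfl fun j _ => measureReal_sum_eq_coeff hm hY hi s j
  · intro a _ b _ hab
    refine Set.disjoint_left.2 fun ω h1 h2 => hab ?_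
    have e1 : ∑ i ∈ s, Y i ω = a := h1
    have e2 : ∑ i ∈ s, Y i ω = b := h2
    rw [e1] at e2
    exact_mod_cast e2
  · intro j _
    exact (Finset.measurable_fun_sum s fun i _ => hm i) (measurableSet_singleton _)

end prob

/-! ### Admissibility of the two explicit tail bounds -/

lemma isTailBound_strongTail : IsTailBound strongTail := by
  intro Ω _ μ _ n k g Y hm hY hi hk hg hmean
  obtain ⟨k, rfl⟩ : ∃ k', k = k' + 1 := ⟨k - 1, by omega⟩
  have hint : ∀ i, ∫ ω, Y i ω ∂μ = μ.real {ω | Y i ω = 1} := by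
    intro i
    have : Y i = indicator {ω | Y i ω = 1} 1 := by
      ext ω
      rcases hY i ω with h | h <;> simp [h]
    calc ∫ ω, Y i ω ∂μ = ∫ ω, indicator {ω | Y i ω = 1} 1 ω ∂μ := by rw [← this]
      _ = μ.real {ω | Y i ω = 1} := integral_indicator_one (hm i (measurableSet_singleton 1))
  have hintg : ∀ i, Integrable (Y i) μ := by
    intro i
    refine Integrable.of_bound (hm i).aestronglyMeasurable 1 (Filter.Eventually.of_forall ?_)
    intro ω
    rcases hY i ω with h | h <;> simp [h]
  rw [integral_finsetSum _ fun i _ => hintg i] at hmean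
  simp only [hint] at hmean
  push_cast at hmean
  have h1 := measureReal_sum_lt_eq hm hY hi Finset.univ (k + 1)
  rw [h1]
  refine (sum_coeff_prod_bernoulliPoly_le (fun i => μ.real {ω | Y i ω = 1})
    (fun i _ => ⟨measureReal_nonneg, measureReal_le_one⟩) k ?_).trans ?_
  · rw [hmean]; nlinarith
  · rw [hmean]
    exact poisson_sum_le_strongTail k hg

lemma strongTail_le_simpleTail {g : ℝ} (hg : 1 ≤ g) : strongTail g ≤ simpleTail g := by
  have h : simpleTail g = Real.exp (-g + (1 - Real.log 2)) := by
    rw [simpleTail, ← add_sub_assoc, Real.exp_sub _ (Real.log 2), Real.exp_log (by norm_num)]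
    ring_nf
  rw [h, strongTail_eq, Real.exp_le_exp]
  have h1 : Real.exp (1 - g) ≤ 1 := Real.exp_le_one_iff.2 (by linarith)
  nlinarith [log_two_lt_one]

lemma isAdmissible_simpleTail : IsAdmissible simpleTail where
  isTailBound := fun Ω _ μ _ n k g Y hm hY hi hk hg hmean =>
    (isTailBound_strongTail Ω μ n k g Y hm hY hi hk hg hmean).trans (strongTail_le_simpleTail hg)
  convex := by
    have h : ConvexOn ℝ (Ici (1 : ℝ)) (fun x : ℝ => Real.exp (1 - x)) := by
      refine (convexOn_exp.comp_affineMap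
        (AffineMap.const ℝ ℝ 1 - AffineMap.id ℝ ℝ)).subset (subset_univ _) (convex_Ici 1)
    have h2 := h.smul (c := (1 / 2 : ℝ)) (by norm_num)
    refine h2.congr fun x _ => ?_
    simp [simpleTail]
    ring
  nonincreasing := by
    intro a _ b _ hab
    simp only [simpleTail]
    have := Real.exp_le_exp.2 (show 1 - b ≤ 1 - a by linarith)
    linarith
  at_one_le := by norm_num [simpleTail]

lemma isAdmissible_strongTail : IsAdmissible strongTail where
  isTailBound := isTailBound_strongTail
  convex := by
    have h : ConvexOn ℝ (Ici (1 : ℝ)) (fun x : ℝ => Real.exp (1 - x)) := by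
      refine (convexOn_exp.comp_affineMap
        (AffineMap.const ℝ ℝ 1 - AffineMap.id ℝ ℝ)).subset (subset_univ _) (convex_Ici 1)
    -- The exponent is already convex, as 1 - log 2 is nonnegative, and exp is convex and
    -- increasing.
    have h2 : ConvexOn ℝ (Ici (1 : ℝ))
        (fun x : ℝ => -x + (1 - Real.log 2) * Real.exp (1 - x)) :=
      (concaveOn_id (convex_Ici 1)).neg.add (h.smul (by linarith [log_two_lt_one]))
    refine ⟨convex_Ici 1, fun x hx y hy a b ha hb hab => ?_⟩
    simp only [strongTail_eq]
    exact (Real.exp_le_exp.2 (h2.2 hx hy ha hb hab)).trans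
      (convexOn_exp.2 (mem_univ _) (mem_univ _) ha hb hab)
  nonincreasing := by
    intro a _ b _ hab
    simp only [strongTail_eq]
    refine Real.exp_le_exp.2 ?_
    have := Real.exp_le_exp.2 (show 1 - b ≤ 1 - a by linarith)
    nlinarith [log_two_lt_one]
  at_one_le := by
    rw [strongTail_eq, Real.exp_le_one_iff]
    simp only [sub_self, Real.exp_zero]
    linarith [Real.log_two_gt_d9]

namespace GMSSC

variable {V E : Type} [Fintype V] [DecidableEq V]

/-! ### The LP relaxation has an optimum solution -/

lemma isClosed_isFeasible (I : GMSSC V E) :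
    IsClosed {p : (V → ℕ → ℝ) × (E → ℕ → ℝ) | I.IsFeasible ⟨p.1, p.2⟩} := by
  have h : {p : (V → ℕ → ℝ) × (E → ℕ → ℝ) | I.IsFeasible ⟨p.1, p.2⟩} =
      {p | ∀ v t, 1 ≤ t → 0 ≤ p.1 v t} ∩ ({p | ∀ e t, 1 ≤ t → 0 ≤ p.2 e t} ∩
        ({p | ∀ t, 1 ≤ t → ∑ v, p.1 v t ≤ 1} ∩
          {p | ∀ e t, 1 ≤ t → ∀ S ⊆ I.edge e, S.card < I.k e → ((I.k e : ℝ) - S.card) ≤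
            ((I.k e : ℝ) - S.card) * p.2 e t +
              ∑ v ∈ I.edge e \ S, ∑ t' ∈ Finset.Ico 1 t, p.1 v t'})) := by
    ext p
    exact ⟨fun h => ⟨h.1, h.2, h.3, h.4⟩, fun h => ⟨h.1, h.2.1, h.2.2.1, h.2.2.2⟩⟩
  rw [h]
  simp only [Set.ofPred_forall]
  refine IsClosed.inter ?_ (IsClosed.inter ?_ (IsClosed.inter ?_ ?_))
  · refine isClosed_iInter fun v => isClosed_iInter fun t => isClosed_iInter fun _ => ?_
    exact isClosed_le (by fun_prop) (by fun_prop)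
  · refine isClosed_iInter fun v => isClosed_iInter fun t => isClosed_iInter fun _ => ?_
    exact isClosed_le (by fun_prop) (by fun_prop)
  · refine isClosed_iInter fun t => isClosed_iInter fun _ => ?_
    exact isClosed_le (by fun_prop) (by fun_prop)
  · refine isClosed_iInter fun e => isClosed_iInter fun t => isClosed_iInter fun _ =>
      isClosed_iInter fun S => isClosed_iInter fun _ => isClosed_iInter fun _ => ?_
    exact isClosed_le (by fun_prop) (by fun_prop)

/-- Infinite sums of continuous nonnegative terms are suprema of continuous functions;
semicontinuity suffices for a minimum on a compact set. -/
lemma lowerSemicontinuous_lpCost {V E : Type} [Fintype E] (I : GMSSC V E) :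
    LowerSemicontinuous
      (fun p : (V → ℕ → ℝ) × (E → ℕ → ℝ) => I.lpCost ⟨p.1, p.2⟩) := by
  simp only [lpCost, ← tsum_fintype (L := .unconditional E)]
  refine lowerSemicontinuous_tsum fun e => lowerSemicontinuous_tsum fun t => ?_
  exact (ENNReal.continuous_ofReal.comp (by fun_prop)).lowerSemicontinuous

/-- Capping `u` at `1` and clearing the unused slot `0` preserves feasibility. -/
lemma IsFeasible.cap {I : GMSSC V E} {s : FracSchedule V E} (h : I.IsFeasible s) :
    I.IsFeasible ⟨fun v t => if t = 0 then 0 else s.x v t,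
      fun e t => if t = 0 then 0 else min (s.u e t) 1⟩ where
  x_nonneg v t ht := by simpa [show t ≠ 0 by omega] using h.x_nonneg v t ht
  u_nonneg e t ht := by simpa [show t ≠ 0 by omega] using h.u_nonneg e t ht
  packing t ht := by simpa [show t ≠ 0 by omega] using h.packing t ht
  knapsackCover e t ht S hS hk := by
    have h1 := h.knapsackCover e t ht S hS hk
    have h2 : ∑ v ∈ I.edge e \ S, ∑ t' ∈ Finset.Ico 1 t, (if t' = 0 then 0 else s.x v t') =
        ∑ v ∈ I.edge e \ S, ∑ t' ∈ Finset.Ico 1 t, s.x v t' := by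
      refine Finset.sum_congr rfl fun v _ => Finset.sum_congr rfl fun t' ht' => ?_
      rw [Finset.mem_Ico] at ht'
      rw [if_neg (by omega)]
    have h3 : 0 ≤ ∑ v ∈ I.edge e \ S, ∑ t' ∈ Finset.Ico 1 t, s.x v t' :=
      Finset.sum_nonneg fun v _ => Finset.sum_nonneg fun t' ht' =>
        h.x_nonneg v t' (Finset.mem_Ico.1 ht').1
    have h4 : (0 : ℝ) < (I.k e : ℝ) - S.card := sub_pos.2 (by exact_mod_cast hk)
    simp only [show t ≠ 0 by omega, if_false]
    rw [h2]
    rcases min_choice (s.u e t) 1 with h5 | h5 <;> rw [h5]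
    · exact h1
    · linarith

lemma IsFeasible.x_le_one {I : GMSSC V E} {s : FracSchedule V E} (h : I.IsFeasible s) (v : V)
    {t : ℕ} (ht : 1 ≤ t) : s.x v t ≤ 1 :=
  (Finset.single_le_sum (f := fun v => s.x v t) (fun w _ => h.x_nonneg w t ht)
    (Finset.mem_univ v)).trans (h.packing t ht)

lemma isFeasible_trivial (I : GMSSC V E) : I.IsFeasible ⟨fun _ _ => 0, fun _ _ => 1⟩ where
  x_nonneg _ _ _ := le_rfl
  u_nonneg _ _ _ := zero_le_one
  packing _ _ := by simp
  knapsackCover _ _ _ _ _ _ := by simp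

/-- The LP attains its minimum: feasible solutions may be taken in a compact box, on which the
cost is lower semicontinuous. -/
lemma exists_isLPOptimal [Fintype E] (I : GMSSC V E) : ∃ s, I.IsLPOptimal s := by
  set K : Set ((V → ℕ → ℝ) × (E → ℕ → ℝ)) :=
    ((univ.pi fun _ => univ.pi fun _ => Icc 0 1) ×ˢ (univ.pi fun _ => univ.pi fun _ => Icc 0 1)) ∩
      {p | I.IsFeasible ⟨p.1, p.2⟩} with hK
  have hKc : IsCompact K :=
    ((isCompact_univ_pi fun _ => isCompact_univ_pi fun _ => isCompact_Icc).prod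
      (isCompact_univ_pi fun _ => isCompact_univ_pi fun _ => isCompact_Icc)).inter_right
        I.isClosed_isFeasible
  have hcap : ∀ s, I.IsFeasible s → ((fun v t => if t = 0 then 0 else s.x v t,
      fun e t => if t = 0 then 0 else min (s.u e t) 1) :
        (V → ℕ → ℝ) × (E → ℕ → ℝ)) ∈ K := by
    intro s hs
    refine ⟨⟨fun v _ t _ => ?_, fun e _ t _ => ?_⟩, hs.cap⟩
    · dsimp only
      split_ifs with h
      · simp
      · exact ⟨hs.x_nonneg v t (by omega), hs.x_le_one v (by omega)⟩
    · dsimp only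
      split_ifs with h
      · simp
      · exact ⟨le_min (hs.u_nonneg e t (by omega)) zero_le_one, min_le_right _ _⟩
  obtain ⟨p, hp, hmin⟩ := (I.lowerSemicontinuous_lpCost.lowerSemicontinuousOn K).exists_isMinOn
    ⟨_, hcap _ I.isFeasible_trivial⟩ hKc
  refine ⟨⟨p.1, p.2⟩, hp.2, fun s hs => (hmin (hcap s hs)).trans ?_⟩
  refine Finset.sum_le_sum fun e _ => ENNReal.tsum_le_tsum fun t => ENNReal.ofReal_le_ofReal ?_
  simp

/-! ### Orderings are feasible solutions of the LP relaxation -/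

lemma le_card_filter_coverTime {V E : Type} [Fintype V] (I : GMSSC V E) (σ : VertexOrdering V) (e : E) :
    I.k e ≤ ((I.edge e).filter fun v => (σ v : ℕ) + 1 ≤ I.coverTime σ e).card := by
  have h : {t : ℕ | I.k e ≤ ((I.edge e).filter fun v => (σ v : ℕ) + 1 ≤ t).card}.Nonempty := by
    refine ⟨Fintype.card V, ?_⟩
    rw [mem_ofPred_eq, Finset.filter_true_of_mem fun v _ => Nat.succ_le_of_lt (σ v).2]
    exact I.k_le e
  exact Nat.sInf_mem h

/-- The integral solution of the LP relaxation that belongs to an ordering. -/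
noncomputable def integralSchedule (I : GMSSC V E) (σ : VertexOrdering V) : FracSchedule V E where
  x v t := if (σ v : ℕ) + 1 = t then 1 else 0
  u e t := if t ≤ I.coverTime σ e then 1 else 0

lemma isFeasible_integralSchedule (I : GMSSC V E) (σ : VertexOrdering V) :
    I.IsFeasible (I.integralSchedule σ) where
  x_nonneg v t _ := by simp only [integralSchedule]; split_ifs <;> simp
  u_nonneg e t _ := by simp only [integralSchedule]; split_ifs <;> simp
  packing t _ := by
    simp only [integralSchedule, Finset.sum_boole]
    have : (Finset.univ.filter fun v => (σ v : ℕ) + 1 = t).card ≤ 1 := by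
      refine Finset.card_le_one.2 fun a ha b hb => ?_
      simp only [Finset.mem_filter, Finset.mem_univ, true_and] at ha hb
      exact σ.injective (Fin.ext (by omega))
    exact_mod_cast this
  knapsackCover e t _ S hS hk := by
    have h4 : (0 : ℝ) < (I.k e : ℝ) - S.card := sub_pos.2 (by exact_mod_cast hk)
    by_cases ht : t ≤ I.coverTime σ e
    · have h0 : 0 ≤ ∑ v ∈ I.edge e \ S, ∑ t' ∈ Finset.Ico 1 t, (I.integralSchedule σ).x v t' :=
        Finset.sum_nonneg fun v _ => Finset.sum_nonneg fun t' _ => by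
          simp only [integralSchedule]; split_ifs <;> simp
      have h1 : (I.integralSchedule σ).u e t = 1 := if_pos ht
      rw [h1]
      linarith
    · have h1 : (I.integralSchedule σ).u e t = 0 := if_neg ht
      have h2 : ∀ v, ∑ t' ∈ Finset.Ico 1 t, (I.integralSchedule σ).x v t' =
          if (σ v : ℕ) + 1 < t then 1 else 0 := by
        intro v
        simp [integralSchedule, Finset.sum_ite_eq]
      rw [h1, mul_zero, zero_add, Finset.sum_congr rfl fun v _ => h2 v, Finset.sum_boole]
      have h3 : I.k e ≤ ((I.edge e \ S).filter fun v => (σ v : ℕ) + 1 < t).card + S.card := by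
        refine (I.le_card_filter_coverTime σ e).trans ?_
        refine (Finset.card_le_card fun v hv => ?_).trans (Finset.card_union_le _ _)
        simp only [Finset.mem_filter, Finset.mem_union, Finset.mem_sdiff] at hv ⊢
        by_cases hvS : v ∈ S
        · exact Or.inr hvS
        · exact Or.inl ⟨⟨hv.1, hvS⟩, by omega⟩
      have h3' : (I.k e : ℝ) ≤
          (((I.edge e \ S).filter fun v => (σ v : ℕ) + 1 < t).card : ℝ) + S.card := by
        exact_mod_cast h3
      linarith

lemma lpCost_integralSchedule {V E : Type} [Fintype V] [Fintype E] (I : GMSSC V E) (σ : VertexOrdering V) :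
    I.lpCost (I.integralSchedule σ) = I.cost σ := by
  rw [lpCost, cost, Nat.cast_sum]
  refine Finset.sum_congr rfl fun e _ => ?_
  rw [tsum_eq_sum (s := Finset.range (I.coverTime σ e))]
  · rw [Finset.sum_congr rfl (g := fun _ => 1)]
    · simp
    · intro t ht
      rw [Finset.mem_range] at ht
      simp [integralSchedule, show t + 1 ≤ I.coverTime σ e by omega]
  · intro t ht
    rw [Finset.mem_range] at ht
    simp [integralSchedule, show ¬ t + 1 ≤ I.coverTime σ e by omega]

/-- A best ordering gives a feasible LP solution of the same cost. -/
lemma IsLPOptimal.lpCost_le_opt [Fintype E] {I : GMSSC V E} {s : FracSchedule V E} (h : I.IsLPOptimal s) :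
    I.lpCost s ≤ I.opt := by
  have : Nonempty (VertexOrdering V) := ⟨Fintype.equivFin V⟩
  obtain ⟨σ, hσ⟩ := Nat.sInf_mem (Set.range_nonempty fun σ : VertexOrdering V => I.cost σ)
  have h1 : I.opt = I.cost σ := hσ.symm
  rw [h1, ← I.lpCost_integralSchedule σ]
  exact h.2 _ (I.isFeasible_integralSchedule σ)

end GMSSC

/-! ### A potential function for sums of tail bounds -/

/-- The tail bound function `P`, extended by `1` to the arguments below `1`. -/
noncomputable def extendedTail (P : ℝ → ℝ) (x : ℝ) : ℝ≥0∞ :=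
  if x < 1 then 1 else ENNReal.ofReal (P x)

/-- The continuous-time cost that remains, in units of the current time, when the mean is at
level `g` and increases at the full rate. -/
noncomputable def tailPotential (P : ℝ → ℝ) (β g : ℝ) : ℝ≥0∞ :=
  ∫⁻ x in Ioi g, extendedTail P x * ENNReal.ofReal (Real.exp ((x - g) / β) / β)

section potential

variable {P : ℝ → ℝ} {β : ℝ}

lemma IsAdmissible.antitone_extendedTail (hP : IsAdmissible P) : Antitone (extendedTail P) := by
  have h1 : ∀ x, 1 ≤ x → P x ≤ 1 := fun x hx =>
    (hP.nonincreasing (mem_Ici.2 le_rfl) (mem_Ici.2 hx) hx).trans hP.at_one_le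
  intro a b hab
  simp only [extendedTail]
  split_ifs with hb ha ha
  · exact le_rfl
  · exact absurd (hab.trans_lt hb) ha
  · exact ENNReal.ofReal_le_one.2 (h1 b (not_lt.1 hb))
  · exact ENNReal.ofReal_le_ofReal
      (hP.nonincreasing (mem_Ici.2 (not_lt.1 ha)) (mem_Ici.2 (not_lt.1 hb)) hab)

lemma lintegral_Ioc_exp_div (hβ : 0 < β) {a b : ℝ} (hab : a ≤ b) :
    ∫⁻ x in Ioc a b, ENNReal.ofReal (Real.exp ((x - a) / β) / β) =
      ENNReal.ofReal (Real.exp ((b - a) / β) - 1) := by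
  have hd : ∀ x, HasDerivAt (fun x => Real.exp ((x - a) / β)) (Real.exp ((x - a) / β) / β) x := by
    intro x
    have h : HasDerivAt (fun x => (x - a) / β) (1 / β) x :=
      ((hasDerivAt_id x).sub_const a).div_const β
    refine h.exp.congr_deriv ?_
    ring
  have hc : Continuous fun x => Real.exp ((x - a) / β) / β := by fun_prop
  rw [← ofReal_integral_eq_lintegral_ofReal, ← intervalIntegral.integral_of_le hab,
    intervalIntegral.integral_eq_sub_of_hasDerivAt (fun x _ => hd x)
      (hc.intervalIntegrable a b)]
  · simp
  · exact (hc.integrableOn_Icc).mono_set Ioc_subset_Icc_self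
  · exact Filter.Eventually.of_forall fun x => by positivity

/-- The integral is split at g' = g + βd. Beyond g' the weight is e^d times the weight based at g';
before g' the tail is at least its value at g', and the weight has integral e^d - 1. -/
lemma le_tailPotential (hP : IsAdmissible P) (hβ : 0 < β) (g : ℝ) {d : ℝ} (hd : 0 ≤ d) :
    ENNReal.ofReal (Real.exp d) * tailPotential P β (g + β * d) +
      ENNReal.ofReal (Real.exp d - 1) * extendedTail P (g + β * d) ≤ tailPotential P β g := by
  set g' := g + β * d with hg'
  have hgg' : g ≤ g' := by rw [hg']; nlinarith
  have hdg : (g' - g) / β = d := by rw [hg']; field_simp; ring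
  rw [tailPotential, tailPotential, ← Ioc_union_Ioi_eq_Ioi hgg',
    lintegral_union measurableSet_Ioi (Ioc_disjoint_Ioi le_rfl), add_comm]
  refine add_le_add ?_ ?_
  · rw [← hdg, ← lintegral_Ioc_exp_div hβ hgg',
      ← lintegral_mul_const _ (by fun_prop)]
    refine setLIntegral_mono' measurableSet_Ioc fun x hx => ?_
    rw [mul_comm]
    exact mul_le_mul_left (hP.antitone_extendedTail hx.2) _
  · rw [← lintegral_const_mul' _ _ ENNReal.ofReal_ne_top]
    refine lintegral_mono fun x => ?_
    dsimp only
    rw [mul_left_comm, ← ENNReal.ofReal_mul (Real.exp_pos _).le, ← mul_div_assoc, ← Real.exp_add,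
      show d + (x - g') / β = (x - g) / β by rw [← hdg]; ring]

lemma tailPotential_antitone (hP : IsAdmissible P) (hβ : 0 < β) :
    Antitone (tailPotential P β) := by
  intro a b hab
  have h := le_tailPotential hP hβ a (d := (b - a) / β) (div_nonneg (by linarith) hβ.le)
  rw [show a + β * ((b - a) / β) = b by field_simp; ring] at h
  refine le_trans ?_ (le_self_add.trans h)
  have h1 : (1 : ℝ≥0∞) ≤ ENNReal.ofReal (Real.exp ((b - a) / β)) := by
    rw [ENNReal.one_le_ofReal, Real.one_le_exp_iff]
    exact div_nonneg (by linarith) hβ.le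
  calc tailPotential P β b = 1 * tailPotential P β b := (one_mul _).symm
    _ ≤ _ := by gcongr

lemma tailPotential_zero_add_one_le_ratio (hP : IsAdmissible P) (hβ : 0 < β) :
    tailPotential P β 0 + 1 ≤ ratio P β := by
  have h1 : tailPotential P β 0 ≤ ENNReal.ofReal (Real.exp (1 / β) - 1) +
      ENNReal.ofReal (Real.exp (1 / β)) * (ENNReal.ofReal (1 / β) *
        ∫⁻ x in Ioi (1 : ℝ), ENNReal.ofReal (P x * Real.exp ((x - 1) / β))) := by
    rw [tailPotential, ← Ioc_union_Ioi_eq_Ioi (zero_le_one' ℝ),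
      lintegral_union measurableSet_Ioi (Ioc_disjoint_Ioi le_rfl)]
    refine add_le_add ?_ ?_
    · have h := lintegral_Ioc_exp_div hβ (zero_le_one' ℝ)
      rw [sub_zero] at h
      rw [← h]
      refine setLIntegral_mono' measurableSet_Ioc fun x hx => ?_
      refine mul_le_of_le_one_left' ?_
      refine (hP.antitone_extendedTail hx.1.le).trans ?_
      simp [extendedTail]
    · rw [← mul_assoc, ← ENNReal.ofReal_mul (Real.exp_pos _).le,
        ← lintegral_const_mul' _ _ ENNReal.ofReal_ne_top]
      refine setLIntegral_mono' measurableSet_Ioi fun x hx => le_of_eq ?_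
      have hx' : ¬ x < 1 := not_lt.2 (le_of_lt hx)
      rw [extendedTail, if_neg hx', ← ENNReal.ofReal_mul' (by positivity),
        ← ENNReal.ofReal_mul (by positivity), show (x - 0) / β = 1 / β + (x - 1) / β by ring,
        Real.exp_add]
      congr 1
      ring
  refine (add_le_add_left h1 1).trans ?_
  rw [add_right_comm, ← ENNReal.ofReal_one, ← ENNReal.ofReal_add _ zero_le_one, ratio, mul_add,
    sub_add_cancel, mul_one]
  rw [sub_nonneg, Real.one_le_exp_iff]
  positivity

/-- A lower bound, relative to the residual requirement, on the mean number of vertices of an edge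
that are scheduled by time `t`, given the values `u` of the LP variables of that edge. -/
noncomputable def meanLevel (β : ℝ) (u : ℕ → ℝ) (t : ℕ) : ℝ :=
  β * ∑ i ∈ Finset.Icc 1 t, (1 - min (u (i + 1)) 1) / i

lemma meanLevel_succ (β : ℝ) (u : ℕ → ℝ) (t : ℕ) :
    meanLevel β u (t + 1) =
      meanLevel β u t + β * ((1 - min (u (t + 2)) 1) / ((t : ℝ) + 1)) := by
  rw [meanLevel, Finset.sum_Icc_succ_top (by omega), mul_add, meanLevel]
  push_cast
  rfl

/-- The second summand is the potential: the cost still to come if u vanished from now on. A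
fraction y = 1 - min(u,1) of a step is paid from the potential, the fraction 1 - y ≤ u from the LP
cost. -/
lemma sum_extendedTail_meanLevel_le (hP : IsAdmissible P) (hβ : 0 < β) {u : ℕ → ℝ}
    (hu : ∀ t, 1 ≤ t → 0 ≤ u t) (hu1 : 1 ≤ u 1) (N : ℕ) :
    ∑ t ∈ Finset.range (N + 1), extendedTail P (meanLevel β u t) +
        ((N : ℝ≥0∞) + 1) * tailPotential P β (meanLevel β u N) ≤
      (tailPotential P β 0 + 1) * ∑ t ∈ Finset.range (N + 1), ENNReal.ofReal (u (t + 1)) := by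
  have hl0 : ∀ t, 0 ≤ meanLevel β u t := by
    intro t
    refine mul_nonneg hβ.le (Finset.sum_nonneg fun i _ => div_nonneg ?_ (Nat.cast_nonneg i))
    exact sub_nonneg.2 (min_le_right _ _)
  have hQ1 : extendedTail P 0 = 1 := by simp [extendedTail]
  have hR : ∀ t, tailPotential P β (meanLevel β u t) + extendedTail P (meanLevel β u t) ≤
      tailPotential P β 0 + 1 := fun t =>
    add_le_add (tailPotential_antitone hP hβ (hl0 t))
      ((hP.antitone_extendedTail (hl0 t)).trans hQ1.le)
  induction N with
  | zero =>
    have h0 : meanLevel β u 0 = 0 := by simp [meanLevel]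
    have h1 : (1 : ℝ≥0∞) ≤ ENNReal.ofReal (u 1) := ENNReal.one_le_ofReal.2 hu1
    simp only [zero_add, Finset.sum_range_one, h0, hQ1, Nat.cast_zero, one_mul]
    rw [add_comm]
    exact le_mul_of_one_le_right' h1
  | succ N ih =>
    rw [Finset.sum_range_succ, Finset.sum_range_succ _ (N + 1), mul_add]
    set u' := u (N + 1 + 1) with hu'
    have hu0 : 0 ≤ u' := hu _ (by omega)
    set y : ℝ := 1 - min u' 1 with hy
    have hy0 : 0 ≤ y := sub_nonneg.2 (min_le_right _ _)
    have hy1 : 0 ≤ 1 - y := by rw [hy, sub_sub_cancel]; exact le_min hu0 zero_le_one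
    have hyu : 1 - y ≤ u' := by rw [hy, sub_sub_cancel]; exact min_le_left _ _
    have hN : (0 : ℝ) < (N : ℝ) + 1 := by positivity
    have hstep := le_tailPotential hP hβ (meanLevel β u N) (d := y / ((N : ℝ) + 1))
      (by positivity)
    rw [← meanLevel_succ] at hstep
    set F' := tailPotential P β (meanLevel β u (N + 1)) with hF'
    set Q' := extendedTail P (meanLevel β u (N + 1)) with hQ'
    have hNc : ((N : ℝ≥0∞) + 1) = ENNReal.ofReal ((N : ℝ) + 1) := by
      rw [ENNReal.ofReal_add (by positivity) zero_le_one]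
      simp
    -- Uses (N+1) e^d ≥ N+1+y for d = y/(N+1), the advance of the level divided by β.
    have h1 : ENNReal.ofReal ((N : ℝ) + 1 + y) * F' + ENNReal.ofReal y * Q' ≤
        ((N : ℝ≥0∞) + 1) * tailPotential P β (meanLevel β u N) := by
      refine le_trans ?_ (mul_le_mul_right hstep _)
      rw [mul_add, ← mul_assoc, ← mul_assoc, hNc, ← ENNReal.ofReal_mul hN.le,
        ← ENNReal.ofReal_mul hN.le]
      have he := Real.add_one_le_exp (y / ((N : ℝ) + 1))
      have hm : ((N : ℝ) + 1) * (y / ((N : ℝ) + 1)) = y := by field_simp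
      gcongr <;> nlinarith
    have h2 : ENNReal.ofReal (1 - y) * F' + ENNReal.ofReal (1 - y) * Q' ≤
        (tailPotential P β 0 + 1) * ENNReal.ofReal u' := by
      rw [← mul_add, mul_comm]
      exact mul_le_mul' (hR _) (ENNReal.ofReal_le_ofReal hyu)
    have h3 : (((N + 1 : ℕ) : ℝ≥0∞) + 1) * F' =
        ENNReal.ofReal ((N : ℝ) + 1 + y) * F' + ENNReal.ofReal (1 - y) * F' := by
      rw [← add_mul, ← ENNReal.ofReal_add (by positivity) hy1]
      push_cast
      rw [hNc, ← ENNReal.ofReal_one, ← ENNReal.ofReal_add hN.le zero_le_one]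
      ring_nf
    have h4 : Q' = ENNReal.ofReal y * Q' + ENNReal.ofReal (1 - y) * Q' := by
      rw [← add_mul, ← ENNReal.ofReal_add hy0 hy1]
      simp
    calc _ = ∑ t ∈ Finset.range (N + 1), extendedTail P (meanLevel β u t) +
          ((ENNReal.ofReal ((N : ℝ) + 1 + y) * F' + ENNReal.ofReal y * Q') +
            (ENNReal.ofReal (1 - y) * F' + ENNReal.ofReal (1 - y) * Q')) := by
          rw [h3]
          nth_rewrite 1 [h4]
          ring
      _ ≤ ∑ t ∈ Finset.range (N + 1), extendedTail P (meanLevel β u t) +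
          (((N : ℝ≥0∞) + 1) * tailPotential P β (meanLevel β u N) +
            (tailPotential P β 0 + 1) * ENNReal.ofReal u') := by gcongr
      _ ≤ _ := by rw [← add_assoc]; gcongr

/-- The contribution of one hyperedge to the cost: the tail bounds at its mean levels sum to at most
`r(β)` times its contribution to the cost of the LP solution. -/
lemma tsum_extendedTail_meanLevel_le (hP : IsAdmissible P) (hβ : 0 < β) {u : ℕ → ℝ}
    (hu : ∀ t, 1 ≤ t → 0 ≤ u t) (hu1 : 1 ≤ u 1) :
    ∑' t, extendedTail P (meanLevel β u t) ≤ ratio P β * ∑' t, ENNReal.ofReal (u (t + 1)) := by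
  rw [ENNReal.tsum_eq_iSup_nat]
  refine iSup_le fun N => ?_
  refine (Finset.sum_le_sum_of_subset (Finset.range_mono N.le_succ)).trans ?_
  refine (le_self_add.trans (sum_extendedTail_meanLevel_le hP hβ hu hu1 N)).trans ?_
  exact mul_le_mul' (tailPotential_zero_add_one_le_ratio hP hβ) (ENNReal.sum_le_tsum _)

end potential

/-! ### The rounded schedule -/

/-- The probability, before truncation at `1`, that the tentative time slot of `v` is at most
`t`. -/
noncomputable def kernelMass {V E : Type} (β : ℝ) (s : FracSchedule V E) (v : V) (t : ℕ) : ℝ :=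
  ∑ i ∈ Finset.Icc 1 t, applyKernel β (s.x v) i

/-- The joint law of the thresholds `α_v`. -/
noncomputable abbrev thresholdLaw (V : Type) [Fintype V] : Measure (V → ℝ) :=
  Measure.pi fun _ : V => (volume : Measure ℝ).restrict (Icc 0 1)

lemma applyKernel_eq (β : ℝ) (a : ℕ → ℝ) (t : ℕ) :
    applyKernel β a t = β / t * ∑ t' ∈ Finset.Icc 1 t, a t' := by
  rw [applyKernel, Finset.mul_sum]
  refine Finset.sum_congr rfl fun t' ht' => ?_
  rw [kernel, if_pos (Finset.mem_Icc.1 ht').2]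

lemma kernelMass_succ {V E : Type} (β : ℝ) (s : FracSchedule V E) (v : V) (t : ℕ) :
    kernelMass β s v (t + 1) = kernelMass β s v t + applyKernel β (s.x v) (t + 1) := by
  rw [kernelMass, Finset.sum_Icc_succ_top (by omega), kernelMass]

lemma alphaPoint_le_iff {z : ℕ → ℝ} (hz : ∀ t, 1 ≤ t → 0 ≤ z t) (a : ℝ) {t : ℕ} (ht : 1 ≤ t) :
    alphaPoint z a ≤ t ↔ a ≤ ∑ i ∈ Finset.Icc 1 t, z i := by
  constructor
  · intro h
    have hne : ((fun t : ℕ => (t : ℕ∞)) ''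
        {t : ℕ | 1 ≤ t ∧ a ≤ ∑ t' ∈ Finset.Icc 1 t, z t'}).Nonempty := by
      by_contra hne
      rw [Set.not_nonempty_iff_eq_empty] at hne
      rw [alphaPoint, hne, sInf_empty, top_le_iff] at h
      exact ENat.natCast_ne_top t h
    obtain ⟨t', ⟨_, ht'a⟩, ht'⟩ := csInf_mem hne
    rw [alphaPoint, ← ht'] at h
    have htt : t' ≤ t := Nat.cast_le.1 h
    refine ht'a.trans (Finset.sum_le_sum_of_subset_of_nonneg
      (Finset.Icc_subset_Icc_right htt) fun i hi _ => hz i (Finset.mem_Icc.1 hi).1)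
  · intro h
    exact sInf_le ⟨t, ⟨ht, h⟩, rfl⟩

lemma card_filter_vertexOrdering_lt {V : Type} [Fintype V] (σ : VertexOrdering V) {c : ℕ}
    (hc : c ≤ Fintype.card V) : (Finset.univ.filter fun v => (σ v : ℕ) < c).card = c := by
  have h : (Finset.univ.filter fun v => (σ v : ℕ) < c).card =
      (Finset.univ.filter fun i : Fin (Fintype.card V) => (i : ℕ) < c).card :=
    Finset.card_bij (fun v _ => σ v) (fun v hv => by simpa using hv)
      (fun _ _ _ _ h => σ.injective h) fun i hi => ⟨σ.symm i, by simpa using hi, by simp⟩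
  rw [h, Fin.card_filter_val_lt, min_eq_right hc]

namespace GMSSC

variable {V E : Type} [Fintype V] [DecidableEq V]

lemma coverTime_le {V E : Type} [Fintype V] (I : GMSSC V E) (σ : VertexOrdering V) (e : E) {c : ℕ}
    (h : I.k e ≤ ((I.edge e).filter fun v => (σ v : ℕ) + 1 ≤ c).card) : I.coverTime σ e ≤ c :=
  Nat.sInf_le h

lemma coverTime_le_card {V E : Type} [Fintype V] (I : GMSSC V E) (σ : VertexOrdering V) (e : E) :
    I.coverTime σ e ≤ Fintype.card V := by
  refine I.coverTime_le σ e ?_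
  rw [Finset.filter_true_of_mem fun v _ => Nat.succ_le_of_lt (σ v).2]
  exact I.k_le e

/-- If `k e` vertices of `e` are tentatively scheduled by time `T`, then the final cover time of `e`
exceeds `k e` by at most the number of other vertices tentatively scheduled by time `T`. -/
lemma coverTime_breakTies_le (I : GMSSC V E) (τ : V → ℕ∞) (ρ : VertexOrdering V) (e : E) (T : ℕ∞)
    (h : I.k e ≤ ((I.edge e).filter fun v => τ v ≤ T).card) :
    I.coverTime (breakTies τ ρ) e ≤
      I.k e + ((I.edge e)ᶜ.filter fun v => τ v ≤ T).card := by
  set σ := breakTies τ ρ with hσ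
  set W := Finset.univ.filter fun v => τ v ≤ T with hW
  set O := (I.edge e)ᶜ.filter fun v => τ v ≤ T with hO
  -- The first `c` vertices of the final order all lie in `W`, and at most `O.card` of them are
  -- outside `e`. The minimum is in fact its first argument, shown in `h4`.
  set c := min (I.k e + O.card) W.card with hc
  have hWc : W.card = ((I.edge e).filter fun v => τ v ≤ T).card + O.card := by
    rw [← Finset.card_union_of_disjoint]
    · congr 1
      ext v
      simp only [hW, hO, Finset.mem_filter, Finset.mem_univ, true_and, Finset.mem_union,
        Finset.mem_compl]
      tauto
    · refine Finset.disjoint_left.2 fun v h1 h2 => ?_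
      simp only [hO, Finset.mem_filter, Finset.mem_compl] at h1 h2
      exact h2.1 h1.1
  have hmem : ∀ v, (σ v : ℕ) < c → v ∈ W := by
    intro v hv
    by_contra hvW
    have h1 : W.card ≤ (σ v : ℕ) := by
      have h2 : (σ v : ℕ) = (Finset.univ.filter fun w =>
          (toLex (τ w, ρ w) : ℕ∞ ×ₗ Fin (Fintype.card V)) < toLex (τ v, ρ v)).card := rfl
      rw [h2]
      refine Finset.card_le_card fun w hw => ?_
      simp only [hW, Finset.mem_filter, Finset.mem_univ, true_and, not_le] at hw hvW ⊢
      exact Prod.Lex.toLex_lt_toLex.2 (Or.inl (hw.trans_lt hvW))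
    exact absurd (hv.trans_le (min_le_right _ _)) (not_lt.2 h1)
  have hcard : (Finset.univ.filter fun v => (σ v : ℕ) < c).card = c :=
    card_filter_vertexOrdering_lt σ ((min_le_right _ _).trans (Finset.card_le_univ W))
  have hsub : (Finset.univ.filter fun v => (σ v : ℕ) < c) ⊆
      ((I.edge e).filter fun v => (σ v : ℕ) + 1 ≤ I.k e + O.card) ∪ O := by
    intro v hv
    simp only [Finset.mem_filter, Finset.mem_univ, true_and] at hv
    have hvW := hmem v hv
    have hvc : (σ v : ℕ) < I.k e + O.card := hv.trans_le (min_le_left _ _)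
    simp only [hW, hO, Finset.mem_filter, Finset.mem_univ, true_and, Finset.mem_union,
      Finset.mem_compl] at hvW ⊢
    by_cases hve : v ∈ I.edge e
    · exact Or.inl ⟨hve, hvc⟩
    · exact Or.inr ⟨hve, hvW⟩
  have h3 := (Finset.card_le_card hsub).trans (Finset.card_union_le _ _)
  rw [hcard] at h3
  have h4 : I.k e + O.card ≤ c := le_min le_rfl (by omega)
  exact I.coverTime_le σ e (by omega)

section mass

variable {I : GMSSC V E} {s : FracSchedule V E} {β : ℝ}

lemma IsFeasible.applyKernel_nonneg (h : I.IsFeasible s) (hβ : 0 ≤ β) (v : V) (t : ℕ) :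
    0 ≤ applyKernel β (s.x v) t := by
  rw [applyKernel_eq]
  exact mul_nonneg (by positivity)
    (Finset.sum_nonneg fun i hi => h.x_nonneg v i (Finset.mem_Icc.1 hi).1)

lemma IsFeasible.kernelMass_nonneg (h : I.IsFeasible s) (hβ : 0 ≤ β) (v : V) (t : ℕ) :
    0 ≤ kernelMass β s v t :=
  Finset.sum_nonneg fun i _ => h.applyKernel_nonneg hβ v i

lemma IsFeasible.tentative_le_iff (h : I.IsFeasible s) (hβ : 0 ≤ β) (α : V → ℝ) (v : V) {t : ℕ}
    (ht : 1 ≤ t) : tentative β s α v ≤ t ↔ α v ≤ kernelMass β s v t :=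
  alphaPoint_le_iff (fun i _ => h.applyKernel_nonneg hβ v i) _ ht

lemma IsFeasible.sum_applyKernel_le (h : I.IsFeasible s) (hβ : 0 ≤ β) {t : ℕ} (ht : 1 ≤ t) :
    ∑ v, applyKernel β (s.x v) t ≤ β := by
  simp only [applyKernel_eq]
  rw [← Finset.mul_sum, Finset.sum_comm]
  have h1 : ∑ t' ∈ Finset.Icc 1 t, ∑ v, s.x v t' ≤ t := by
    calc _ ≤ ∑ _t' ∈ Finset.Icc 1 t, (1 : ℝ) :=
          Finset.sum_le_sum fun i hi => h.packing i (Finset.mem_Icc.1 hi).1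
      _ = t := by simp
  have ht0 : (0 : ℝ) < t := by exact_mod_cast ht
  calc _ ≤ β / t * t := mul_le_mul_of_nonneg_left h1 (by positivity)
    _ = β := by field_simp

lemma IsFeasible.sum_kernelMass_le (h : I.IsFeasible s) (hβ : 0 ≤ β) (t : ℕ) :
    ∑ v, kernelMass β s v t ≤ β * t := by
  simp only [kernelMass]
  rw [Finset.sum_comm]
  calc _ ≤ ∑ _i ∈ Finset.Icc 1 t, β :=
        Finset.sum_le_sum fun i hi => h.sum_applyKernel_le hβ (Finset.mem_Icc.1 hi).1
    _ = β * t := by simp [mul_comm]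

/-- The knapsack cover inequalities bound the mean number of vertices of `e \ S` that are
scheduled by time `t`. -/
lemma IsFeasible.le_sum_kernelMass (h : I.IsFeasible s) (hβ : 0 ≤ β) (e : E) {S : Finset V}
    (hS : S ⊆ I.edge e) (hk : S.card < I.k e) (t : ℕ) :
    ((I.k e : ℝ) - S.card) * meanLevel β (s.u e) t ≤
      ∑ v ∈ I.edge e \ S, kernelMass β s v t := by
  simp only [kernelMass]
  rw [Finset.sum_comm, meanLevel, Finset.mul_sum, Finset.mul_sum]
  refine Finset.sum_le_sum fun i hi => ?_
  have hi1 := (Finset.mem_Icc.1 hi).1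
  have hi0 : (0 : ℝ) < i := by exact_mod_cast hi1
  simp only [applyKernel_eq]
  rw [← Finset.mul_sum]
  -- The constraint of slot i + 1 sums over t' < i + 1, exactly the slots that the kernel averages
  -- at time i. Capping u first makes `min (u (i + 1)) 1` appear.
  have h1 := h.cap.knapsackCover e (i + 1) (by omega) S hS hk
  have h2 : ∑ v ∈ I.edge e \ S, ∑ t' ∈ Finset.Ico 1 (i + 1), (if t' = 0 then 0 else s.x v t') =
      ∑ v ∈ I.edge e \ S, ∑ t' ∈ Finset.Icc 1 i, s.x v t' := by
    refine Finset.sum_congr rfl fun v _ => ?_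
    rw [Finset.Ico_add_one_right_eq_Icc]
    refine Finset.sum_congr rfl fun t' ht' => ?_
    rw [if_neg (by have := (Finset.mem_Icc.1 ht').1; omega)]
  simp only [Nat.add_eq_zero_iff, one_ne_zero, and_false, if_false] at h1
  rw [h2] at h1
  calc _ = β / i * (((I.k e : ℝ) - S.card) * (1 - min (s.u e (i + 1)) 1)) := by ring
    _ ≤ _ := mul_le_mul_of_nonneg_left (by linarith) (by positivity)

end mass

/-! ### The tentative cover times -/

/-- The number of vertices of `e` whose threshold is reached by time `t`. -/
noncomputable def scheduledCount {V E : Type} (I : GMSSC V E) (β : ℝ) (s : FracSchedule V E)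
    (e : E) (t : ℕ) (α : V → ℝ) : ℕ :=
  ∑ v ∈ I.edge e, if α v ≤ kernelMass β s v t then 1 else 0

lemma scheduledCount_eq_card {V E : Type} (I : GMSSC V E) (β : ℝ) (s : FracSchedule V E)
    (e : E) (t : ℕ) (α : V → ℝ) :
    I.scheduledCount β s e t α =
      ((I.edge e).filter fun v => α v ≤ kernelMass β s v t).card := by
  rw [scheduledCount, Finset.card_filter]

lemma measurable_scheduledCount {V E : Type} (I : GMSSC V E) (β : ℝ) (s : FracSchedule V E) (e : E) (t : ℕ) :
    Measurable (I.scheduledCount β s e t) :=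
  Finset.measurable_fun_sum _ fun v _ =>
    Measurable.ite (measurableSet_le (measurable_pi_apply v) measurable_const)
      measurable_const measurable_const

end GMSSC

/-! ### The law of the thresholds and the tail bound for one hyperedge -/

section law

variable {V : Type} [Fintype V]

instance : IsProbabilityMeasure ((volume : Measure ℝ).restrict (Icc 0 1)) :=
  ⟨by simp⟩

lemma thresholdLaw_preimage (v : V) {B : Set ℝ} (hB : MeasurableSet B) :
    thresholdLaw V {α | α v ∈ B} = volume (B ∩ Icc 0 1) := by
  have h := (measurePreserving_eval
    (fun _ : V => (volume : Measure ℝ).restrict (Icc 0 1)) v).measure_preimage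
      hB.nullMeasurableSet
  rw [Measure.restrict_apply hB] at h
  exact h

lemma thresholdLaw_le (v : V) (a : ℝ) :
    thresholdLaw V {α | α v ≤ a} ≤ ENNReal.ofReal a := by
  refine (thresholdLaw_preimage v (B := Iic a) measurableSet_Iic).trans_le ?_
  calc _ ≤ volume (Icc 0 a) := measure_mono fun x hx => ⟨hx.2.1, hx.1⟩
    _ = _ := by simp

lemma thresholdLaw_eq (v : V) {a : ℝ} (ha : a ≤ 1) :
    thresholdLaw V {α | α v ≤ a} = ENNReal.ofReal a := by
  refine (thresholdLaw_preimage v (B := Iic a) measurableSet_Iic).trans ?_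
  have h : Iic a ∩ Icc 0 1 = Icc 0 a := by
    ext x
    simp only [mem_inter_iff, mem_Iic, mem_Icc]
    constructor
    · rintro ⟨h1, h2, _⟩; exact ⟨h2, h1⟩
    · rintro ⟨h1, h2⟩; exact ⟨h2, h1, h2.trans ha⟩
  rw [h]
  simp

lemma thresholdLaw_Ioc_le (v : V) (a b : ℝ) :
    thresholdLaw V {α | α v ∈ Ioc a b} ≤ ENNReal.ofReal (b - a) := by
  refine (thresholdLaw_preimage v measurableSet_Ioc).trans_le ?_
  calc _ ≤ volume (Ioc a b) := measure_mono inter_subset_left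
    _ = _ := by simp

lemma ae_thresholdLaw_le_one : ∀ᵐ α ∂thresholdLaw V, ∀ v, α v ≤ 1 := by
  rw [ae_all_iff]
  intro v
  rw [ae_iff]
  have h := thresholdLaw_preimage v (B := Ioi (1 : ℝ)) measurableSet_Ioi
  have h2 : Ioi (1 : ℝ) ∩ Icc 0 1 = ∅ := by
    ext x
    simp only [mem_inter_iff, mem_Ioi, mem_Icc, mem_empty_iff_false, iff_false]
    rintro ⟨h1, _, h3⟩
    linarith
  rw [h2, measure_empty] at h
  simpa using h

lemma iIndepFun_thresholdLaw : iIndepFun (fun (v : V) (α : V → ℝ) => α v) (thresholdLaw V) :=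
  iIndepFun_pi (X := fun _ x => x) fun _ => aemeasurable_id

end law

namespace GMSSC

variable {V E : Type} [Fintype V] [DecidableEq V] {I : GMSSC V E} {s : FracSchedule V E} {β : ℝ}

lemma IsFeasible.thresholdLaw_scheduledCount_lt_le (h : I.IsFeasible s) (hβ : 0 ≤ β)
    {P : ℝ → ℝ} (hP : IsAdmissible P) (e : E) {t : ℕ} (ht : 1 ≤ meanLevel β (s.u e) t) :
    thresholdLaw V {α | I.scheduledCount β s e t α < I.k e} ≤
      ENNReal.ofReal (P (meanLevel β (s.u e) t)) := by
  -- Truncation at 1 would lose mass on these vertices. They are scheduled almost surely, so they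
  -- are removed and the requirement is lowered by their number; on the rest, probability equals
  -- mass.
  set S := (I.edge e).filter fun v => 1 ≤ kernelMass β s v t with hS
  have hSe : S ⊆ I.edge e := Finset.filter_subset _ _
  set R := I.edge e \ S with hR
  have hRlt : ∀ v ∈ R, kernelMass β s v t < 1 := by
    intro v hv
    simp only [hR, hS, Finset.mem_sdiff, Finset.mem_filter, not_and, not_le] at hv
    exact hv.2 hv.1
  have hcount : ∀ α : V → ℝ, (∀ v, α v ≤ 1) → I.scheduledCount β s e t α =
      S.card + ∑ v ∈ R, if α v ≤ kernelMass β s v t then 1 else 0 := by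
    intro α hα
    rw [scheduledCount, ← Finset.sum_sdiff hSe, add_comm]
    congr 1
    rw [Finset.card_eq_sum_ones]
    refine Finset.sum_congr rfl fun v hv => if_pos ((hα v).trans ?_)
    exact (Finset.mem_filter.1 hv).2
  by_cases hk : I.k e ≤ S.card
  · have h0 : thresholdLaw V {α | I.scheduledCount β s e t α < I.k e} = 0 := by
      refine measure_mono_null (fun α hα => ?_) (ae_iff.1 (ae_thresholdLaw_le_one (V := V)))
      intro hα1
      have h1 : I.scheduledCount β s e t α < I.k e := hα
      rw [hcount α hα1] at h1
      omega
    rw [h0]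
    exact zero_le
  rw [not_le] at hk
  set n := Fintype.card V with hn
  set f : Fin n ≃ V := (Fintype.equivFin V).symm with hf
  -- Vertices outside `R` contribute the constant 0, so the family can be indexed by all of `Fin n`.
  set φ : V → ℝ → ℝ := fun v x => if v ∈ R ∧ x ≤ kernelMass β s v t then 1 else 0 with hφ
  have hφm : ∀ v, Measurable (φ v) := fun v =>
    Measurable.ite ((MeasurableSet.const _).inter (measurableSet_le measurable_id measurable_const))
      measurable_const measurable_const
  have hind : iIndepFun (fun (i : Fin n) (α : V → ℝ) => φ (f i) (α (f i))) (thresholdLaw V) :=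
    (iIndepFun_thresholdLaw.precomp f.injective).comp (fun i => φ (f i)) fun i => hφm (f i)
  have hsum : ∀ α : V → ℝ, ∑ i : Fin n, φ (f i) (α (f i)) =
      ∑ v ∈ R, if α v ≤ kernelMass β s v t then 1 else 0 := by
    intro α
    rw [f.sum_comp (fun v => φ v (α v)), ← Finset.sum_filter_add_sum_filter_not Finset.univ (· ∈ R)]
    rw [Finset.sum_eq_zero (s := Finset.univ.filter fun v => v ∉ R), add_zero]
    · rw [Finset.filter_mem_eq_inter, Finset.univ_inter]
      exact Finset.sum_congr rfl fun v hv => by simp [hφ, hv]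
    · intro v hv
      rw [Finset.mem_filter] at hv
      simp [hφ, hv.2]
  have hmean : ∫ α, ∑ i : Fin n, φ (f i) (α (f i)) ∂thresholdLaw V =
      ∑ v ∈ R, kernelMass β s v t := by
    simp only [hsum]
    have hterm : ∀ v, (fun α : V → ℝ => if α v ≤ kernelMass β s v t then (1 : ℝ) else 0) =
        indicator {α | α v ≤ kernelMass β s v t} 1 := by
      intro v
      ext α
      simp [indicator_apply]
    have hms : ∀ v, MeasurableSet {α : V → ℝ | α v ≤ kernelMass β s v t} := fun v =>
      measurableSet_le (measurable_pi_apply v) measurable_const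
    rw [integral_finsetSum]
    · refine Finset.sum_congr rfl fun v hv => ?_
      rw [hterm, integral_indicator_one (hms v), measureReal_def,
        thresholdLaw_eq v (hRlt v hv).le, ENNReal.toReal_ofReal (h.kernelMass_nonneg hβ v t)]
    · intro v _
      rw [hterm]
      exact (integrable_const (1 : ℝ)).indicator (hms v)
  set k' := I.k e - S.card with hk'
  have hk'1 : 1 ≤ k' := by omega
  have hk'c : (k' : ℝ) = (I.k e : ℝ) - S.card := by rw [hk', Nat.cast_sub hk.le]
  have hk'0 : (0 : ℝ) < k' := by exact_mod_cast hk'1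
  set g := (∑ v ∈ R, kernelMass β s v t) / k' with hg
  have hlg : meanLevel β (s.u e) t ≤ g := by
    rw [hg, le_div_iff₀ hk'0, hk'c, mul_comm]
    exact h.le_sum_kernelMass hβ e hSe hk t
  have htail := hP.isTailBound (V → ℝ) (thresholdLaw V) n k' g
    (fun i α => φ (f i) (α (f i))) (fun i => (hφm _).comp (measurable_pi_apply _))
    (fun i α => by simp only [hφ]; split_ifs <;> simp) hind hk'1 (ht.trans hlg)
    (by rw [hmean, hg]; field_simp)
  have hle : P g ≤ P (meanLevel β (s.u e) t) :=
    hP.nonincreasing (mem_Ici.2 ht) (mem_Ici.2 (ht.trans hlg)) hlg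
  calc thresholdLaw V {α | I.scheduledCount β s e t α < I.k e} ≤
        thresholdLaw V {α | ∑ i : Fin n, φ (f i) (α (f i)) < k'} := by
        refine measure_mono_ae ?_
        filter_upwards [ae_thresholdLaw_le_one (V := V)] with α hα h1
        have h2 : I.scheduledCount β s e t α < I.k e := h1
        rw [hcount α hα] at h2
        have h3 : (∑ v ∈ R, if α v ≤ kernelMass β s v t then 1 else 0) < k' := by omega
        have h4 : ((∑ v ∈ R, if α v ≤ kernelMass β s v t then 1 else 0 : ℕ) : ℝ) < k' := by
          exact_mod_cast h3
        change ∑ i : Fin n, φ (f i) (α (f i)) < k'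
        rw [hsum]
        push_cast at h4
        exact h4
    _ = ENNReal.ofReal ((thresholdLaw V).real {α | ∑ i : Fin n, φ (f i) (α (f i)) < k'}) :=
        (ofReal_measureReal).symm
    _ ≤ _ := ENNReal.ofReal_le_ofReal (htail.trans hle)

end GMSSC

namespace GMSSC

variable {V E : Type} [Fintype V] [DecidableEq V]

/-! ### The expected cover time of an edge -/

/-- An upper bound, for thresholds `α`, on the final cover time of `e`: the requirement of `e`, plus
the number of other vertices scheduled by time `m` or until `e` is covered, whichever is later. -/
noncomputable def coverBound (I : GMSSC V E) (β : ℝ) (s : FracSchedule V E) (e : E) (m : ℕ)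
    (α : V → ℝ) : ℝ≥0∞ :=
  I.k e + ∑ v ∈ (I.edge e)ᶜ, indicator {α | α v ≤ kernelMass β s v m} 1 α +
    ∑' j, ∑ v ∈ (I.edge e)ᶜ, indicator
      ({α | α v ∈ Ioc (kernelMass β s v (m + j)) (kernelMass β s v (m + j + 1))} ∩
        {α | I.scheduledCount β s e (m + j) α < I.k e}) 1 α +
    Fintype.card V * indicator (⋂ j, {α | I.scheduledCount β s e (m + j) α < I.k e}) 1 α

variable {I : GMSSC V E} {s : FracSchedule V E} {β : ℝ}

lemma IsFeasible.coverTime_le_coverBound (h : I.IsFeasible s) (hβ : 0 ≤ β) (e : E) {m : ℕ}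
    (hm : 1 ≤ m) (α : V → ℝ) (ρ : VertexOrdering V) :
    (I.coverTime (breakTies (tentative β s α) ρ) e : ℝ≥0∞) ≤ I.coverBound β s e m α := by
  by_cases hex : ∃ j, I.k e ≤ I.scheduledCount β s e (m + j) α
  · classical
    set j₀ := Nat.find hex with hj₀
    have hlt : ∀ j < j₀, I.scheduledCount β s e (m + j) α < I.k e := fun j hj =>
      not_le.1 (Nat.find_min hex hj)
    have hspec := Nat.find_spec hex
    rw [← hj₀, scheduledCount_eq_card] at hspec
    have hτ : ∀ v, tentative β s α v ≤ ((m + j₀ : ℕ) : ℕ∞) ↔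
        α v ≤ kernelMass β s v (m + j₀) := fun v => h.tentative_le_iff hβ α v (by omega)
    have h1 := I.coverTime_breakTies_le (tentative β s α) ρ e ((m + j₀ : ℕ) : ℕ∞)
      (by simpa only [hτ] using hspec)
    simp only [hτ] at h1
    -- A vertex scheduled by time m + n is either scheduled by time m or in a single later step, and
    -- before that step `e` was uncovered because n ≤ `j₀`.
    have hv : ∀ v, ∀ n ≤ j₀, (if α v ≤ kernelMass β s v (m + n) then (1 : ℝ≥0∞) else 0) ≤
        indicator {α | α v ≤ kernelMass β s v m} 1 α +
          ∑ j ∈ Finset.range n, indicator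
            ({α | α v ∈ Ioc (kernelMass β s v (m + j)) (kernelMass β s v (m + j + 1))} ∩
              {α | I.scheduledCount β s e (m + j) α < I.k e}) 1 α := by
      intro v n
      induction n with
      | zero => intro _; simp [indicator_apply]
      | succ n ih =>
        intro hn
        rw [Finset.sum_range_succ]
        refine le_trans ?_ ((add_le_add_left (ih (by omega)) _).trans_eq (add_assoc _ _ _))
        by_cases ha : α v ≤ kernelMass β s v (m + n)
        · rw [if_pos ha]
          refine le_trans ?_ le_self_add
          split_ifs <;> simp
        · by_cases hb : α v ≤ kernelMass β s v (m + n + 1)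
          · have hmem : α ∈ {α : V → ℝ | α v ∈
                Ioc (kernelMass β s v (m + n)) (kernelMass β s v (m + n + 1))} ∩
                {α | I.scheduledCount β s e (m + n) α < I.k e} :=
              ⟨⟨not_le.1 ha, hb⟩, hlt n (by omega)⟩
            rw [indicator_of_mem hmem, Pi.one_apply]
            refine le_trans ?_ le_add_self
            split_ifs <;> simp
          · rw [if_neg (by rwa [← add_assoc])]
            exact zero_le
    calc (I.coverTime (breakTies (tentative β s α) ρ) e : ℝ≥0∞) ≤
          ((I.k e + ((I.edge e)ᶜ.filter fun v => α v ≤ kernelMass β s v (m + j₀)).card : ℕ) :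
            ℝ≥0∞) := by exact_mod_cast h1
      _ = I.k e + ∑ v ∈ (I.edge e)ᶜ,
            (if α v ≤ kernelMass β s v (m + j₀) then (1 : ℝ≥0∞) else 0) := by
          rw [Finset.card_filter]
          push_cast
          rfl
      _ ≤ I.k e + ∑ v ∈ (I.edge e)ᶜ, (indicator {α | α v ≤ kernelMass β s v m} 1 α +
            ∑ j ∈ Finset.range j₀, indicator
              ({α | α v ∈ Ioc (kernelMass β s v (m + j)) (kernelMass β s v (m + j + 1))} ∩
                {α | I.scheduledCount β s e (m + j) α < I.k e}) 1 α) := by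
          gcongr with v _
          exact hv v j₀ le_rfl
      _ ≤ I.coverBound β s e m α := by
          rw [Finset.sum_add_distrib, Finset.sum_comm, ← add_assoc]
          refine le_trans ?_ le_self_add
          gcongr
          exact ENNReal.sum_le_tsum _
  · push Not at hex
    have h1 : α ∈ ⋂ j, {α | I.scheduledCount β s e (m + j) α < I.k e} :=
      mem_iInter.2 hex
    rw [coverBound, indicator_of_mem h1]
    refine le_trans ?_ le_add_self
    simpa using I.coverTime_le_card _ e

/-- The count depends only on thresholds of vertices in `e`, hence is independent of the threshold
of `v`. -/
lemma thresholdLaw_inter_scheduledCount (e : E) {v : V} (hv : v ∉ I.edge e) (a b : ℝ) (t : ℕ) :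
    thresholdLaw V ({α | α v ∈ Ioc a b} ∩ {α | I.scheduledCount β s e t α < I.k e}) =
      thresholdLaw V {α | α v ∈ Ioc a b} *
        thresholdLaw V {α | I.scheduledCount β s e t α < I.k e} := by
  have hind := iIndepFun_thresholdLaw.indepFun_finset {v} (I.edge e)
    (Finset.disjoint_singleton_left.2 hv) fun v => measurable_pi_apply v
  set ψ : ({w // w ∈ I.edge e} → ℝ) → ℕ := fun b =>
    ∑ w : I.edge e, if b w ≤ kernelMass β s w t then 1 else 0 with hψ
  have hψm : Measurable ψ := Finset.measurable_fun_sum _ fun w _ =>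
    Measurable.ite (measurableSet_le (measurable_pi_apply w) measurable_const)
      measurable_const measurable_const
  have hψe : ∀ α : V → ℝ, ψ (fun w => α w) = I.scheduledCount β s e t α := fun α =>
    Finset.sum_coe_sort (I.edge e) fun w => if α w ≤ kernelMass β s w t then 1 else 0
  have h := hind.measure_inter_preimage_eq_mul
    ((fun c : ({v} : Finset V) → ℝ => c ⟨v, Finset.mem_singleton_self v⟩) ⁻¹' Ioc a b)
    (ψ ⁻¹' Iio (I.k e)) ((measurable_pi_apply _) measurableSet_Ioc) (hψm measurableSet_Iio)
  convert h using 3 <;> ext α <;> simp [hψe]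

lemma measurable_coverBound (I : GMSSC V E) (β : ℝ) (s : FracSchedule V E) (e : E) (m : ℕ) :
    Measurable (I.coverBound β s e m) := by
  have hms1 : ∀ v, MeasurableSet {α : V → ℝ | α v ≤ kernelMass β s v m} := fun v =>
    measurableSet_le (measurable_pi_apply v) measurable_const
  have hms2 : ∀ j, MeasurableSet {α | I.scheduledCount β s e (m + j) α < I.k e} := fun j =>
    I.measurable_scheduledCount β s e (m + j) measurableSet_Iio
  have hms3 : ∀ v j, MeasurableSet
      ({α : V → ℝ | α v ∈ Ioc (kernelMass β s v (m + j)) (kernelMass β s v (m + j + 1))} ∩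
        {α | I.scheduledCount β s e (m + j) α < I.k e}) := fun v j =>
    (measurable_pi_apply v measurableSet_Ioc).inter (hms2 j)
  have hms4 : MeasurableSet (⋂ j, {α | I.scheduledCount β s e (m + j) α < I.k e}) :=
    MeasurableSet.iInter hms2
  have hm1 : ∀ v, Measurable (indicator {α : V → ℝ | α v ≤ kernelMass β s v m}
      (1 : (V → ℝ) → ℝ≥0∞)) := fun v => measurable_one.indicator (hms1 v)
  have hm3 : ∀ v j, Measurable (indicator
      ({α : V → ℝ | α v ∈ Ioc (kernelMass β s v (m + j)) (kernelMass β s v (m + j + 1))} ∩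
        {α | I.scheduledCount β s e (m + j) α < I.k e}) (1 : (V → ℝ) → ℝ≥0∞)) :=
    fun v j => measurable_one.indicator (hms3 v j)
  have hm3' : ∀ j, Measurable fun α => ∑ v ∈ (I.edge e)ᶜ, indicator
      ({α : V → ℝ | α v ∈ Ioc (kernelMass β s v (m + j)) (kernelMass β s v (m + j + 1))} ∩
        {α | I.scheduledCount β s e (m + j) α < I.k e}) (1 : (V → ℝ) → ℝ≥0∞) α :=
    fun j => Finset.measurable_fun_sum _ fun v _ => hm3 v j
  have hm4 : Measurable (indicator
      (⋂ j, {α | I.scheduledCount β s e (m + j) α < I.k e}) (1 : (V → ℝ) → ℝ≥0∞)) :=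
    measurable_one.indicator hms4
  exact ((measurable_const.add (Finset.measurable_fun_sum _ fun v _ => hm1 v)).add
    (Measurable.tsum hm3')).add (hm4.const_mul _)

lemma IsFeasible.lintegral_coverBound_le (h : I.IsFeasible s) (hβ : 0 ≤ β)
    {P : ℝ → ℝ} (hP : IsAdmissible P) (e : E) {m : ℕ}
    (hm : 1 ≤ meanLevel β (s.u e) m) (hmono : Monotone (meanLevel β (s.u e)))
    (hfin : ∑' j, ENNReal.ofReal (P (meanLevel β (s.u e) (m + j))) ≠ ⊤) :
    ∫⁻ α, I.coverBound β s e m α ∂thresholdLaw V ≤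
      ENNReal.ofReal β * (m + ∑' j, ENNReal.ofReal (P (meanLevel β (s.u e) (m + j)))) := by
  have htail : ∀ j, thresholdLaw V {α | I.scheduledCount β s e (m + j) α < I.k e} ≤
      ENNReal.ofReal (P (meanLevel β (s.u e) (m + j))) := fun j =>
    h.thresholdLaw_scheduledCount_lt_le hβ hP e (hm.trans (hmono (Nat.le_add_right m j)))
  have hms1 : ∀ v, MeasurableSet {α : V → ℝ | α v ≤ kernelMass β s v m} := fun v =>
    measurableSet_le (measurable_pi_apply v) measurable_const
  have hms2 : ∀ j, MeasurableSet {α | I.scheduledCount β s e (m + j) α < I.k e} := fun j =>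
    I.measurable_scheduledCount β s e (m + j) measurableSet_Iio
  have hms3 : ∀ v j, MeasurableSet
      ({α : V → ℝ | α v ∈ Ioc (kernelMass β s v (m + j)) (kernelMass β s v (m + j + 1))} ∩
        {α | I.scheduledCount β s e (m + j) α < I.k e}) := fun v j =>
    (measurable_pi_apply v measurableSet_Ioc).inter (hms2 j)
  have hms4 : MeasurableSet (⋂ j, {α | I.scheduledCount β s e (m + j) α < I.k e}) :=
    MeasurableSet.iInter hms2
  -- Summable tail bounds tend to 0, so `e` is almost surely covered eventually.
  have hnull : thresholdLaw V (⋂ j, {α | I.scheduledCount β s e (m + j) α < I.k e}) = 0 := by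
    refine le_antisymm ?_ zero_le
    refine ge_of_tendsto' (ENNReal.tendsto_atTop_zero_of_tsum_ne_top hfin) fun j => ?_
    exact (measure_mono (iInter_subset _ j)).trans (htail j)
  -- The level being at least 1 at time m, the mass of `e` itself is at least `k e` (take S empty).
  -- So both summands fit into the total mass, at most βm.
  have hbase : (I.k e : ℝ≥0∞) + ∑ v ∈ (I.edge e)ᶜ,
      thresholdLaw V {α | α v ≤ kernelMass β s v m} ≤ ENNReal.ofReal β * m := by
    have h1 := h.le_sum_kernelMass hβ e (Finset.empty_subset _) (I.k_pos e) m
    have h2 := h.sum_kernelMass_le hβ m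
    rw [← Finset.sum_add_sum_compl (I.edge e)] at h2
    simp only [Finset.card_empty, Nat.cast_zero, sub_zero, Finset.sdiff_empty] at h1
    have h3 : (I.k e : ℝ) ≤ I.k e * meanLevel β (s.u e) m :=
      le_mul_of_one_le_right (Nat.cast_nonneg _) hm
    calc _ ≤ ENNReal.ofReal (I.k e) + ∑ v ∈ (I.edge e)ᶜ, ENNReal.ofReal (kernelMass β s v m) := by
          rw [ENNReal.ofReal_natCast]
          gcongr with v _
          exact thresholdLaw_le v _
      _ = ENNReal.ofReal (I.k e + ∑ v ∈ (I.edge e)ᶜ, kernelMass β s v m) := by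
          rw [ENNReal.ofReal_add (Nat.cast_nonneg _)
            (Finset.sum_nonneg fun v _ => h.kernelMass_nonneg hβ v m),
            ENNReal.ofReal_sum_of_nonneg fun v _ => h.kernelMass_nonneg hβ v m]
      _ ≤ ENNReal.ofReal (β * m) := ENNReal.ofReal_le_ofReal (by linarith)
      _ = _ := by rw [ENNReal.ofReal_mul hβ, ENNReal.ofReal_natCast]
  have hstep : ∀ j, ∑ v ∈ (I.edge e)ᶜ, thresholdLaw V
      ({α | α v ∈ Ioc (kernelMass β s v (m + j)) (kernelMass β s v (m + j + 1))} ∩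
        {α | I.scheduledCount β s e (m + j) α < I.k e}) ≤
      ENNReal.ofReal β * ENNReal.ofReal (P (meanLevel β (s.u e) (m + j))) := by
    intro j
    calc _ ≤ ∑ v ∈ (I.edge e)ᶜ, ENNReal.ofReal (applyKernel β (s.x v) (m + j + 1)) *
          ENNReal.ofReal (P (meanLevel β (s.u e) (m + j))) := by
          refine Finset.sum_le_sum fun v hv => ?_
          rw [thresholdLaw_inter_scheduledCount e (Finset.mem_compl.1 hv)]
          refine mul_le_mul' ((thresholdLaw_Ioc_le v _ _).trans_eq ?_) (htail j)
          rw [kernelMass_succ, add_sub_cancel_left]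
      _ ≤ _ := by
          rw [← Finset.sum_mul,
            ← ENNReal.ofReal_sum_of_nonneg fun v _ => h.applyKernel_nonneg hβ v _]
          gcongr
          refine (Finset.sum_le_sum_of_subset_of_nonneg (Finset.subset_univ _)
            fun v _ _ => h.applyKernel_nonneg hβ v _).trans ?_
          exact h.sum_applyKernel_le hβ (by omega)
  have hm1 : ∀ v, Measurable (indicator {α : V → ℝ | α v ≤ kernelMass β s v m}
      (1 : (V → ℝ) → ℝ≥0∞)) := fun v => measurable_one.indicator (hms1 v)
  have hm3 : ∀ v j, Measurable (indicator
      ({α : V → ℝ | α v ∈ Ioc (kernelMass β s v (m + j)) (kernelMass β s v (m + j + 1))} ∩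
        {α | I.scheduledCount β s e (m + j) α < I.k e}) (1 : (V → ℝ) → ℝ≥0∞)) :=
    fun v j => measurable_one.indicator (hms3 v j)
  have hm3' : ∀ j, Measurable fun α => ∑ v ∈ (I.edge e)ᶜ, indicator
      ({α : V → ℝ | α v ∈ Ioc (kernelMass β s v (m + j)) (kernelMass β s v (m + j + 1))} ∩
        {α | I.scheduledCount β s e (m + j) α < I.k e}) (1 : (V → ℝ) → ℝ≥0∞) α :=
    fun j => Finset.measurable_fun_sum _ fun v _ => hm3 v j
  have hm4 : Measurable (indicator
      (⋂ j, {α | I.scheduledCount β s e (m + j) α < I.k e}) (1 : (V → ℝ) → ℝ≥0∞)) :=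
    measurable_one.indicator hms4
  simp only [coverBound]
  rw [lintegral_add_right _ (hm4.const_mul _), lintegral_add_right _ (Measurable.tsum hm3'),
    lintegral_add_right _ (Finset.measurable_fun_sum _ fun v _ => hm1 v), lintegral_const,
    measure_univ, mul_one, lintegral_finsetSum _ fun v _ => hm1 v,
    lintegral_tsum fun j => (hm3' j).aemeasurable, lintegral_const_mul _ hm4,
    lintegral_indicator_one hms4, hnull, mul_zero, add_zero, mul_add]
  refine add_le_add ?_ ?_
  · simpa only [lintegral_indicator_one (hms1 _)] using hbase
  · rw [← ENNReal.tsum_mul_left]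
    refine ENNReal.tsum_le_tsum fun j => ?_
    rw [lintegral_finsetSum _ fun v _ => hm3 v j]
    simpa only [lintegral_indicator_one (hms3 _ j)] using hstep j

/-- A measurable upper bound on the cover time of `e` whose mean is at most `β r(β)` times the
contribution of `e` to the cost of the LP solution. -/
lemma IsFeasible.exists_coverTime_bound (h : I.IsFeasible s) (hβ : 1 ≤ β)
    {P : ℝ → ℝ} (hP : IsAdmissible P) (e : E) :
    ∃ B : (V → ℝ) → ℝ≥0∞, Measurable B ∧
      (∀ α ρ, (I.coverTime (breakTies (tentative β s α) ρ) e : ℝ≥0∞) ≤ B α) ∧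
      ∫⁻ α, B α ∂thresholdLaw V ≤ ENNReal.ofReal β * ratio P β *
        ∑' t : ℕ, ENNReal.ofReal (s.u e (t + 1)) := by
  have hβ0 : 0 < β := by linarith
  have hu1 : 1 ≤ s.u e 1 := by
    have hk : (0 : ℝ) < I.k e := by exact_mod_cast I.k_pos e
    have h1 := h.knapsackCover e 1 le_rfl ∅ (Finset.empty_subset _) (I.k_pos e)
    simp only [Finset.card_empty, Nat.cast_zero, sub_zero, Finset.Ico_self, Finset.sum_empty,
      Finset.sum_const_zero, add_zero] at h1
    exact le_of_mul_le_mul_left (by linarith) hk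
  have hle := tsum_extendedTail_meanLevel_le hP hβ0 (h.u_nonneg e) hu1
  -- In the divergent case the right-hand side is infinite and any bound will do.
  by_cases htop : ∑' t, extendedTail P (meanLevel β (s.u e) t) = ⊤
  · refine ⟨fun _ => Fintype.card V, measurable_const,
      fun α ρ => Nat.cast_le.2 (I.coverTime_le_card _ e), ?_⟩
    have : ENNReal.ofReal β * ratio P β * ∑' t : ℕ, ENNReal.ofReal (s.u e (t + 1)) = ⊤ := by
      rw [htop, top_le_iff] at hle
      rw [mul_assoc, hle, ENNReal.mul_top]
      simpa using hβ0
    rw [this]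
    exact le_top
  have hmono : Monotone (meanLevel β (s.u e)) := monotone_nat_of_le_succ fun t => by
    rw [meanLevel_succ]
    have : min (s.u e (t + 1 + 1)) 1 ≤ 1 := min_le_right _ _
    exact le_add_of_nonneg_right
      (mul_nonneg hβ0.le (div_nonneg (sub_nonneg.2 this) (by positivity)))
  -- If the level stayed below 1, every term of the series would be 1, contradicting convergence.
  have hex : ∃ t, 1 ≤ meanLevel β (s.u e) t := by
    by_contra! hlt
    refine htop ?_
    simp only [extendedTail, hlt, if_true]
    exact ENNReal.tsum_const_eq_top_of_ne_zero one_ne_zero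
  obtain ⟨m, hm, hmin⟩ : ∃ m, 1 ≤ meanLevel β (s.u e) m ∧
      ∀ t < m, meanLevel β (s.u e) t < 1 := by
    classical
    exact ⟨Nat.find hex, Nat.find_spec hex, fun t ht => not_le.1 (Nat.find_min hex ht)⟩
  have hm0 : 1 ≤ m := by
    rw [Nat.one_le_iff_ne_zero]
    intro h0
    rw [h0] at hm
    norm_num [meanLevel] at hm
  -- The times 0, …, m - 1 contribute 1 each.
  have hsplit : (m : ℝ≥0∞) + ∑' j, ENNReal.ofReal (P (meanLevel β (s.u e) (m + j))) =
      ∑' t, extendedTail P (meanLevel β (s.u e) t) := by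
    rw [← ENNReal.summable.sum_add_tsum_nat_add' (k := m)
      (f := fun t => extendedTail P (meanLevel β (s.u e) t))]
    congr 1
    · have h1 : ∀ t ∈ Finset.range m, extendedTail P (meanLevel β (s.u e) t) = 1 := fun t ht =>
        if_pos (hmin t (Finset.mem_range.1 ht))
      rw [Finset.sum_congr rfl h1, Finset.sum_const, Finset.card_range, nsmul_one]
    · refine tsum_congr fun j => ?_
      rw [add_comm, extendedTail, if_neg (not_lt.2 (hm.trans (hmono (Nat.le_add_left m j))))]
  have hfin : ∑' j, ENNReal.ofReal (P (meanLevel β (s.u e) (m + j))) ≠ ⊤ :=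
    ne_top_of_le_ne_top htop (le_add_self.trans_eq hsplit)
  refine ⟨I.coverBound β s e m, I.measurable_coverBound β s e m,
    h.coverTime_le_coverBound hβ0.le e hm0, ?_⟩
  refine (h.lintegral_coverBound_le hβ0.le hP e hm hmono hfin).trans ?_
  rw [hsplit, mul_assoc]
  gcongr

lemma IsFeasible.expectedCost_le [Fintype E] (h : I.IsFeasible s) (hβ : 1 ≤ β)
    {P : ℝ → ℝ} (hP : IsAdmissible P) :
    I.expectedCost β s ≤ ENNReal.ofReal β * ratio P β * I.lpCost s := by
  choose B hBm hB hBi using fun e => h.exists_coverTime_bound hβ hP e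
  have : Nonempty (VertexOrdering V) := ⟨Fintype.equivFin V⟩
  have hcost : ∀ α ρ, (I.cost (breakTies (tentative β s α) ρ) : ℝ≥0∞) ≤ ∑ e, B e α := by
    intro α ρ
    rw [cost, Nat.cast_sum]
    exact Finset.sum_le_sum fun e _ => hB e α ρ
  calc I.expectedCost β s ≤ ∫⁻ α, ∑ e, B e α ∂thresholdLaw V := by
        refine lintegral_mono fun α => ?_
        refine ENNReal.div_le_of_le_mul ?_
        refine (Finset.sum_le_sum fun ρ _ => hcost α ρ).trans ?_
        rw [Finset.sum_const, nsmul_eq_mul, mul_comm, Finset.card_univ]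
    _ = ∑ e, ∫⁻ α, B e α ∂thresholdLaw V := lintegral_finsetSum _ fun e _ => hBm e
    _ ≤ ∑ e, ENNReal.ofReal β * ratio P β * ∑' t : ℕ, ENNReal.ofReal (s.u e (t + 1)) :=
        Finset.sum_le_sum fun e _ => hBi e
    _ = _ := by rw [← Finset.mul_sum, lpCost]

end GMSSC

/-! ### The approximation guarantee -/

/-- The algorithm has approximation ratio at most `β r(β)`. -/
theorem hasApproxRatio {β : ℝ} (hβ : 1 ≤ β) {P : ℝ → ℝ} (hP : IsAdmissible P) :
    HasApproxRatio β (ENNReal.ofReal β * ratio P β) := by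
  intro V E _ _ _ I
  refine ⟨I.exists_isLPOptimal, fun s hs => ?_⟩
  exact (hs.1.expectedCost_le hβ hP).trans (mul_le_mul_right hs.lpCost_le_opt _)

lemma HasApproxRatio.mono {β : ℝ} {r r' : ℝ≥0∞} (h : HasApproxRatio β r) (hr : r ≤ r') :
    HasApproxRatio β r' := by
  intro V E _ _ _ I
  exact ⟨(h V E I).1, fun s hs => ((h V E I).2 s hs).trans (mul_le_mul_left hr _)⟩

/-! ### The two explicit tail bounds -/

lemma lintegral_Ioi_one_exp {A κ : ℝ} (hA : 0 ≤ A) (hκ : 0 < κ) :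
    ∫⁻ x in Ioi (1 : ℝ), ENNReal.ofReal (A * Real.exp (-κ * (x - 1))) =
      ENNReal.ofReal (A / κ) := by
  have heq : (fun x => A * Real.exp (-κ * (x - 1))) =
      fun x => (A * Real.exp κ) * Real.exp (-κ * x) := by
    ext x
    rw [mul_assoc, ← Real.exp_add]
    ring_nf
  have hint : IntegrableOn (fun x => A * Real.exp (-κ * (x - 1))) (Ioi 1) := by
    rw [heq]
    exact (integrableOn_exp_mul_Ioi (neg_lt_zero.2 hκ) 1).const_mul _
  rw [← ofReal_integral_eq_lintegral_ofReal hint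
    (Filter.Eventually.of_forall fun x => by positivity), heq, integral_const_mul,
    integral_exp_mul_Ioi (neg_lt_zero.2 hκ)]
  congr 1
  have := Real.exp_ne_zero κ
  rw [mul_one, Real.exp_neg]
  field_simp

lemma ofReal_mul_ratio_simpleTail {β : ℝ} (hβ : 1 < β) :
    ENNReal.ofReal β * ratio simpleTail β =
      ENNReal.ofReal (β * (2 * β - 1) * Real.exp (1 / β) / (2 * β - 2)) := by
  have hβ0 : 0 < β := by linarith
  have hβ1 : β - 1 ≠ 0 := by linarith
  have hκ : 0 < 1 - 1 / β := by
    rw [sub_pos, div_lt_one hβ0]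
    exact hβ
  have heq : ∀ x, simpleTail x * Real.exp ((x - 1) / β) =
      1 / 2 * Real.exp (-(1 - 1 / β) * (x - 1)) := by
    intro x
    rw [simpleTail, div_mul_eq_mul_div, ← Real.exp_add]
    ring_nf
  simp only [ratio, heq]
  rw [lintegral_Ioi_one_exp (by norm_num) hκ, ← ENNReal.ofReal_mul (by positivity),
    ← ENNReal.ofReal_one, ← ENNReal.ofReal_add (by norm_num) (by positivity),
    ← ENNReal.ofReal_mul (by positivity), ← ENNReal.ofReal_mul hβ0.le]
  congr 1
  have h2 : 2 * β - 2 = 2 * (β - 1) := by ring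
  have h3 : 1 - 1 / β = (β - 1) / β := by field_simp
  rw [h2, h3]
  field_simp
  ring

lemma simpleTail_ratio_numeric :
    (2.191 : ℝ) * (2 * 2.191 - 1) * Real.exp (1 / 2.191) / (2 * 2.191 - 2) ≤ 4.9102 := by
  have h := Real.exp_bound' (x := 1 / 2.191) (by norm_num) (by norm_num) (n := 8) (by norm_num)
  norm_num [Finset.sum_range_succ, Nat.factorial] at h
  norm_num
  linarith

/-- The coefficients of a polynomial bounding `exp` from above on `[0, 1]`. -/
noncomputable def expMajorantCoeff (j : ℕ) : ℝ := if j < 7 then 1 / (j.factorial : ℝ) else 1 / 4410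

lemma expMajorantCoeff_nonneg (j : ℕ) : 0 ≤ expMajorantCoeff j := by
  rw [expMajorantCoeff]
  split_ifs <;> positivity

/-- The last coefficient is the Taylor remainder constant 8/(7!·7) = 1/4410 of `Real.exp_bound'`. -/
lemma exp_le_sum_expMajorantCoeff {z : ℝ} (h0 : 0 ≤ z) (h1 : z ≤ 1) :
    Real.exp z ≤ ∑ j ∈ Finset.range 8, expMajorantCoeff j * z ^ j := by
  have h := Real.exp_bound' h0 h1 (n := 7) (by norm_num)
  norm_num [Finset.sum_range_succ, Nat.factorial] at h
  norm_num [Finset.sum_range_succ, Nat.factorial, expMajorantCoeff]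
  linarith

/-- With y = e^{1-x}, the integrand is e^{-x} exp((1 - log 2) y) e^{b(x-1)}. Bounding the middle
factor by a polynomial in y leaves pure exponentials, with rates j + 1 - b, to integrate. -/
lemma lintegral_strongTail_le {b c : ℝ} (hb : b < 1) (hc : 1 - Real.log 2 ≤ c) (hc1 : c ≤ 1) :
    ∫⁻ x in Ioi (1 : ℝ), ENNReal.ofReal (strongTail x * Real.exp (b * (x - 1))) ≤
      ENNReal.ofReal (Real.exp (-1) *
        ∑ j ∈ Finset.range 8, expMajorantCoeff j * c ^ j / (j + 1 - b)) := by
  have hc0 : 0 ≤ c := by linarith [log_two_lt_one]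
  have hκ : ∀ j : ℕ, 0 < (j : ℝ) + 1 - b := fun j => by
    have : (0 : ℝ) ≤ j := Nat.cast_nonneg j
    linarith
  set A : ℕ → ℝ := fun j => Real.exp (-1) * (expMajorantCoeff j * c ^ j) with hA
  have hA0 : ∀ j, 0 ≤ A j := fun j =>
    mul_nonneg (Real.exp_pos _).le (mul_nonneg (expMajorantCoeff_nonneg j) (by positivity))
  have hpt : ∀ x ∈ Ioi (1 : ℝ), ENNReal.ofReal (strongTail x * Real.exp (b * (x - 1))) ≤
      ∑ j ∈ Finset.range 8, ENNReal.ofReal (A j * Real.exp (-((j : ℝ) + 1 - b) * (x - 1))) := by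
    intro x hx
    have hx1 : (1 : ℝ) < x := hx
    have hy1 : Real.exp (1 - x) ≤ 1 := Real.exp_le_one_iff.2 (by linarith)
    have hy0 := (Real.exp_pos (1 - x)).le
    rw [← ENNReal.ofReal_sum_of_nonneg fun j _ => mul_nonneg (hA0 j) (Real.exp_pos _).le]
    refine ENNReal.ofReal_le_ofReal ?_
    have h1 : Real.exp ((1 - Real.log 2) * Real.exp (1 - x)) ≤
        ∑ j ∈ Finset.range 8, expMajorantCoeff j * (c * Real.exp (1 - x)) ^ j := by
      refine (Real.exp_le_exp.2 (mul_le_mul_of_nonneg_right hc hy0)).trans ?_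
      exact exp_le_sum_expMajorantCoeff (mul_nonneg hc0 hy0) (mul_le_one₀ hc1 hy0 hy1)
    rw [strongTail_eq, Real.exp_add]
    calc _ ≤ Real.exp (-x) * (∑ j ∈ Finset.range 8,
            expMajorantCoeff j * (c * Real.exp (1 - x)) ^ j) * Real.exp (b * (x - 1)) := by
          gcongr
      _ = _ := by
          rw [Finset.mul_sum, Finset.sum_mul]
          refine Finset.sum_congr rfl fun j _ => ?_
          have : Real.exp (-1) * Real.exp (-((j : ℝ) + 1 - b) * (x - 1)) =
              Real.exp (-x) * Real.exp (1 - x) ^ j * Real.exp (b * (x - 1)) := by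
            rw [← Real.exp_nat_mul, ← Real.exp_add, ← Real.exp_add, ← Real.exp_add]
            ring_nf
          rw [mul_pow, hA]
          linear_combination (-(expMajorantCoeff j * c ^ j)) * this
  refine (setLIntegral_mono' measurableSet_Ioi hpt).trans_eq ?_
  rw [lintegral_finsetSum _ fun j _ => by fun_prop,
    Finset.sum_congr rfl fun j _ => lintegral_Ioi_one_exp (hA0 j) (hκ j),
    ← ENNReal.ofReal_sum_of_nonneg fun j _ => div_nonneg (hA0 j) (hκ j).le, Finset.mul_sum]
  simp only [hA, mul_div_assoc]

lemma ofReal_mul_ratio_strongTail_le :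
    ENNReal.ofReal 2.0715 * ratio strongTail 2.0715 ≤ ENNReal.ofReal 4.642 := by
  -- The target 4.642 leaves very little slack, so log 2, e^{-1}, e^{1/β} and the sum are all
  -- bounded to many digits.
  have hlog : 1 - Real.log 2 ≤ 0.3068528197 := by linarith [Real.log_two_gt_d9]
  have hint := lintegral_strongTail_le (b := 1 / 2.0715) (by norm_num) hlog (by norm_num)
  have heq : ∀ x : ℝ, (x - 1) / 2.0715 = 1 / 2.0715 * (x - 1) := fun x => by ring
  simp only [ratio, heq]
  have hexp1 := Real.exp_neg_one_lt_d9.le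
  have hexp : Real.exp (1 / 2.0715) ≤ 1.62051173 := by
    have h := Real.exp_bound' (x := 1 / 2.0715) (by norm_num) (by norm_num) (n := 10) (by norm_num)
    refine h.trans ?_
    norm_num [Finset.sum_range_succ, Nat.factorial]
  set S : ℝ := ∑ j ∈ Finset.range 8, expMajorantCoeff j * 0.3068528197 ^ j /
    (j + 1 - 1 / 2.0715) with hS
  have hS0 : 0 ≤ S := Finset.sum_nonneg fun j _ => by
    have : (0 : ℝ) ≤ j := Nat.cast_nonneg j
    refine div_nonneg (mul_nonneg (expMajorantCoeff_nonneg j) (by norm_num)) ?_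
    norm_num
    linarith
  have hS1 : S ≤ 2.1556706 := by
    rw [hS]
    norm_num [Finset.sum_range_succ, Nat.factorial, expMajorantCoeff]
  calc _ ≤ ENNReal.ofReal 2.0715 * (ENNReal.ofReal 1.62051173 *
        (1 + ENNReal.ofReal (1 / 2.0715) * ENNReal.ofReal (0.3678794412 * S))) := by
        gcongr
        exact hint.trans (ENNReal.ofReal_le_ofReal (by gcongr))
    _ = ENNReal.ofReal (2.0715 * (1.62051173 * (1 + 1 / 2.0715 * (0.3678794412 * S)))) := by
        rw [← ENNReal.ofReal_mul (by norm_num), ← ENNReal.ofReal_one,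
          ← ENNReal.ofReal_add (by norm_num) (by positivity),
          ← ENNReal.ofReal_mul (by norm_num), ← ENNReal.ofReal_mul (by norm_num)]
    _ ≤ _ := ENNReal.ofReal_le_ofReal (by linarith)

theorem mainTheorem1 :
    (∀ (β : ℝ), 1 ≤ β → ∀ P : ℝ → ℝ, IsAdmissible P →
      HasApproxRatio β (ENNReal.ofReal β * ratio P β)) ∧
    (IsAdmissible simpleTail ∧
      (∀ β : ℝ, 1 < β →
        ENNReal.ofReal β * ratio simpleTail β =
          ENNReal.ofReal (β * (2 * β - 1) * Real.exp (1 / β) / (2 * β - 2)) ∧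
        HasApproxRatio β
          (ENNReal.ofReal (β * (2 * β - 1) * Real.exp (1 / β) / (2 * β - 2)))) ∧
      (2.191 : ℝ) * (2 * 2.191 - 1) * Real.exp (1 / 2.191) / (2 * 2.191 - 2) ≤ 4.9102 ∧
      HasApproxRatio 2.191 (ENNReal.ofReal 4.9102)) ∧
    (IsAdmissible strongTail ∧
      ENNReal.ofReal 2.0715 * ratio strongTail 2.0715 ≤ ENNReal.ofReal 4.642 ∧
      HasApproxRatio 2.0715 (ENNReal.ofReal 4.642)) := by
  have hsimple : ∀ β : ℝ, 1 < β → HasApproxRatio β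
      (ENNReal.ofReal (β * (2 * β - 1) * Real.exp (1 / β) / (2 * β - 2))) := fun β hβ =>
    ofReal_mul_ratio_simpleTail hβ ▸ hasApproxRatio hβ.le isAdmissible_simpleTail
  exact ⟨fun β hβ P hP => hasApproxRatio hβ hP,
    ⟨isAdmissible_simpleTail, fun β hβ => ⟨ofReal_mul_ratio_simpleTail hβ, hsimple β hβ⟩,
      simpleTail_ratio_numeric,
      (hsimple 2.191 (by norm_num)).mono (ENNReal.ofReal_le_ofReal simpleTail_ratio_numeric)⟩,
    ⟨isAdmissible_strongTail, ofReal_mul_ratio_strongTail_le,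
      (hasApproxRatio (by norm_num) isAdmissible_strongTail).mono
        ofReal_mul_ratio_strongTail_le⟩⟩
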